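/- An instance $I=(A,H,u;k)$ of house allocation with binary utilities consists of $n=|A|$ agents, $m=|H|$ houses, utilities $u_a(h)\in\{0,1\}$ ($a$ \emph{values} $h$ if $u_a(h)=1$) and an integer $k\ge 0$. An allocation is an injection $\Phi:A\to H$; agent $a$ envies $b$ if $u_a(\Phi(a))<u_a(\Phi(b))$, and the envy of $a$ is the number of agents that $a$ envies. OHA, EHA and UHA ask whether some allocation has, respectively, at most $k$ envious agents, maximum envy at most $k$, total envy at most $k$. A house is a dummy if no agent values it, an agent is a dummy if it values no house; $D$ and $D'$ denote the sets of dummy houses and dummy agents. An expansion of $X\subseteq A$ into $Y\subseteq H$ is a set $M$ of pairs $(a,h)\in X\times Y$ such that $a$ values $h$, every agent of $X$ is in exactly one pair, and exactly $|X|$ houses of $Y$ occur in the pairs. Consider the following two reduction rules, both of which keep $k$. (R1) If $|D|\ge n$, stop and return a trivial yes-instance (a fixed one with two agents and two houses, in which each agent values exactly its own house). (R2) If $|H\setminus D|\ge|A\setminus D'|$ and there are nonempty $X\subseteq A\setminus D'$ and $Y\subseteq H\setminus D$ such that no house of $Y$ is valued by an agent outside $X$, together with an expansion $M$ of $X$ into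 $Y$, then take such $X,Y,M$ and remove all agents and houses that occur in $M$. \textbf{Theorem.} (1) Every instance $J$, with $n'$ agents and $m'$ houses, that is obtained from an instance $I$ with $n$ agents and $m$ houses by applying R1 and R2 exhaustively has the same $k$ and satisfies $n'\le\max(n,2)$, $m'\le 2(n'-1)$, and $n'\le m'$ if $n\le m$. Moreover, $I$ is a yes-instance of OHA if and only if $J$ is, and the same holds for EHA and for UHA. (2) There is a polynomial-time algorithm that maps every instance $I$ to an instance $f(I)$ obtained from $I$ by applying R1 and R2 exhaustively. (3) If the budget $k$ of $f(I)$ is in addition lowered to $\min(k,n'^2)$, where $n'$ is the number of agents of $f(I)$, the resulting map is a polynomial kernelization of each of OHA, EHA and UHA parameterized by the number $n$ of agents: it is computable in polynomial time, it maps every instance to an equivalent one, and the total size of its output (with the budget in binary) plus the output's number of agents is at most a polynomial in $n$. -/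

import Mathlib

namespace HouseAllocation

/-! ### House allocation with binary utilities -/

/-- An instance of house allocation with binary utilities: `n` agents, `m` houses, utilities
`u a h ∈ {0, 1}`, and the budget `k` of the decision problems. -/
structure Instance where
  n : ℕ
  m : ℕ
  u : Fin n → Fin m → Fin 2
  k : ℕ

namespace Instance

variable (I : Instance)

/-- An allocation is an injection from the agents to the houses. -/
abbrev Allocation : Type := Fin I.n ↪ Fin I.m

/-- Agent `a` values house `h`; these are the edges of the preference graph. -/
def Values (a : Fin I.n) (h : Fin I.m) : Prop := I.u a h = 1

/-- A house is a dummy if every agent has utility zero for it. -/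
def IsDummyHouse (h : Fin I.m) : Prop := ∀ a, I.u a h = 0

/-- An agent is a dummy if it has utility zero for every house. -/
def IsDummyAgent (a : Fin I.n) : Prop := ∀ h, I.u a h = 0

open Classical in
/-- The set `D` of dummy houses. -/
noncomputable def dummyHouses : Finset (Fin I.m) := Finset.univ.filter I.IsDummyHouse

open Classical in
/-- The set `D'` of dummy agents. -/
noncomputable def dummyAgents : Finset (Fin I.n) := Finset.univ.filter I.IsDummyAgent

/-- Under `Φ`, agent `a` envies agent `b`. -/
def Envies (Φ : I.Allocation) (a b : Fin I.n) : Prop := I.u a (Φ a) < I.u a (Φ b)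

open Classical in
/-- The amount of envy experienced by `a`: the number of agents that `a` envies. -/
noncomputable def envy (Φ : I.Allocation) (a : Fin I.n) : ℕ :=
  (Finset.univ.filter fun b => I.Envies Φ a b).card

/-- The number of envious agents. -/
noncomputable def numEnvious (Φ : I.Allocation) : ℕ :=
  (Finset.univ.filter fun a => 1 ≤ I.envy Φ a).card

/-- The maximum envy (zero if there is no agent). -/
noncomputable def maxEnvy (Φ : I.Allocation) : ℕ := Finset.univ.sup fun a => I.envy Φ a

/-- The total envy. -/
noncomputable def totalEnvy (Φ : I.Allocation) : ℕ := ∑ a, I.envy Φ a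

/-- Optimal House Allocation: some allocation has at most `k` envious agents. -/
def OHA : Prop := ∃ Φ : I.Allocation, I.numEnvious Φ ≤ I.k

/-- Egalitarian House Allocation: some allocation has maximum envy at most `k`. -/
def EHA : Prop := ∃ Φ : I.Allocation, I.maxEnvy Φ ≤ I.k

/-- Utilitarian House Allocation: some allocation has total envy at most `k`. -/
def UHA : Prop := ∃ Φ : I.Allocation, I.totalEnvy Φ ≤ I.k

/-- The size of an instance: agents, houses and utility entries are listed explicitly, the
budget is written in binary. -/
def size : ℕ := I.n + I.m + I.n * I.m + Nat.size I.k

/-- The instance with its budget `k` lowered to `n ^ 2` if it was larger. -/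
def truncate : Instance := { I with k := min I.k (I.n ^ 2) }

/-! ### The two reduction rules -/

/-- The set `M` of edges of the preference graph is an expansion of `X` into `Y`: all its edges
join `X` to `Y`, every agent of `X` lies on exactly one edge of `M`, and `M` saturates exactly
`|X|` houses of `Y`. -/
def IsExpansion (X : Finset (Fin I.n)) (Y : Finset (Fin I.m))
    (M : Finset (Fin I.n × Fin I.m)) : Prop :=
  (∀ e ∈ M, I.Values e.1 e.2 ∧ e.1 ∈ X ∧ e.2 ∈ Y) ∧
  (∀ a ∈ X, ∃! h, (a, h) ∈ M) ∧
  (M.image Prod.snd).card = X.card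

/-- Up to the numbering of agents and houses, `J` arises from `I` by eliminating the agents in
`X` and the houses in `Z`, with the same budget. -/
def Eliminates (J : Instance) (X : Finset (Fin I.n)) (Z : Finset (Fin I.m)) : Prop :=
  J.k = I.k ∧
  ∃ (α : Fin J.n ↪ Fin I.n) (β : Fin J.m ↪ Fin I.m),
    (∀ a, a ∈ Set.range α ↔ a ∉ X) ∧ (∀ h, h ∈ Set.range β ↔ h ∉ Z) ∧
    ∀ a h, J.u a h = I.u (α a) (β h)

/-- The first rule is applicable: there are at least as many dummy houses as agents. -/
def Rule1 : Prop := I.n ≤ I.dummyHouses.card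

/-- The second rule turns `I` into `J`. It needs at least as many non-dummy houses as non-dummy
agents. It takes nonempty sets `X` of non-dummy agents and `Y` of non-dummy houses such that no
house in `Y` is valued by an agent outside `X`, with an expansion `M` of `X` into `Y`, and
eliminates all agents and houses saturated by `M`. -/
def Rule2 (J : Instance) : Prop :=
  I.dummyAgentsᶜ.card ≤ I.dummyHousesᶜ.card ∧
  ∃ (X : Finset (Fin I.n)) (Y : Finset (Fin I.m)) (M : Finset (Fin I.n × Fin I.m)),
    X ⊆ I.dummyAgentsᶜ ∧ Y ⊆ I.dummyHousesᶜ ∧ X.Nonempty ∧ Y.Nonempty ∧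
    I.IsExpansion X Y M ∧ (∀ h ∈ Y, ∀ a, I.Values a h → a ∈ X) ∧
    I.Eliminates J (M.image Prod.fst) (M.image Prod.snd)

/-- A trivial yes-instance with budget `k`: two agents, two houses, each agent values exactly
the house with its own number. -/
def trivialYes (k : ℕ) : Instance where
  n := 2
  m := 2
  u a h := if a = h then 1 else 0
  k := k

end Instance

/-- `ReducesTo I J`: an exhaustive application of the two rules to `I` ends with `J`. The first
rule stops and returns the trivial yes-instance (the budget is kept). -/
inductive ReducesTo : Instance → Instance → Prop
  | rule1 (I : Instance) : I.Rule1 → ReducesTo I (Instance.trivialYes I.k)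
  | rule2 (I J K : Instance) : I.Rule2 J → ReducesTo J K → ReducesTo I K
  | reduced (I : Instance) : ¬ I.Rule1 → (∀ J, ¬ I.Rule2 J) → ReducesTo I I

/-! ### Running time: a random access machine

Programs work on variables and arrays of natural numbers. Addition and truncated subtraction
are the only arithmetic operations (there is no multiplication), so the unit cost measure is
polynomially related to the running time of Turing machines. -/

/-- A memory state: variables and arrays, both named by natural numbers. -/
structure State where
  var : ℕ → ℕ
  arr : ℕ → ℕ → ℕ

/-- Arithmetic expressions; `get a e` reads entry `e` of the array named `a`. -/
inductive Exp : Type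
  | const (c : ℕ)
  | var (x : ℕ)
  | add (e f : Exp)
  | sub (e f : Exp)
  | get (a : ℕ) (e : Exp)

/-- The value of an expression. -/
def Exp.eval (s : State) : Exp → ℕ
  | .const c => c
  | .var x => s.var x
  | .add e f => e.eval s + f.eval s
  | .sub e f => e.eval s - f.eval s
  | .get a e => s.arr a (e.eval s)

/-- The cost of evaluating an expression: one unit for each operation. -/
def Exp.cost : Exp → ℕ
  | .const _ => 1
  | .var _ => 1
  | .add e f => e.cost + f.cost + 1
  | .sub e f => e.cost + f.cost + 1
  | .get _ e => e.cost + 1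

/-- Programs. Conditions test whether an expression is nonzero. -/
inductive Prog : Type
  | skip
  | assign (x : ℕ) (e : Exp)
  | put (a : ℕ) (i e : Exp)
  | seq (p q : Prog)
  | ite (e : Exp) (p q : Prog)
  | loop (e : Exp) (p : Prog)

/-- The state after `x := v`. -/
def State.setVar (s : State) (x v : ℕ) : State :=
  { s with var := Function.update s.var x v }

/-- The state after `a[i] := v`. -/
def State.setArr (s : State) (a i v : ℕ) : State :=
  { s with arr := Function.update s.arr a (Function.update (s.arr a) i v) }

/-- `Exec p s t s'`: started in `s`, the program `p` halts in `s'` after exactly `t` steps. -/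
inductive Exec : Prog → State → ℕ → State → Prop
  | skip (s : State) : Exec .skip s 1 s
  | assign (s : State) (x : ℕ) (e : Exp) :
      Exec (.assign x e) s (e.cost + 1) (s.setVar x (e.eval s))
  | put (s : State) (a : ℕ) (i e : Exp) :
      Exec (.put a i e) s (i.cost + e.cost + 1) (s.setArr a (i.eval s) (e.eval s))
  | seq {p q : Prog} {s s₁ s₂ : State} {t₁ t₂ : ℕ} :
      Exec p s t₁ s₁ → Exec q s₁ t₂ s₂ → Exec (.seq p q) s (t₁ + t₂) s₂
  | ite_true {e : Exp} {p q : Prog} {s s' : State} {t : ℕ} :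
      e.eval s ≠ 0 → Exec p s t s' → Exec (.ite e p q) s (e.cost + t + 1) s'
  | ite_false {e : Exp} {p q : Prog} {s s' : State} {t : ℕ} :
      e.eval s = 0 → Exec q s t s' → Exec (.ite e p q) s (e.cost + t + 1) s'
  | loop_stop {e : Exp} {p : Prog} {s : State} :
      e.eval s = 0 → Exec (.loop e p) s (e.cost + 1) s
  | loop_step {e : Exp} {p : Prog} {s s₁ s₂ : State} {t₁ t₂ : ℕ} :
      e.eval s ≠ 0 → Exec p s t₁ s₁ → Exec (.loop e p) s₁ t₂ s₂ →
      Exec (.loop e p) s (e.cost + t₁ + t₂ + 1) s₂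

/-- The input state of an instance: variables 0, 1, 2 hold `n`, `m`, `k`, array 0 holds the
utility matrix row by row, and all other memory is zero. -/
def Instance.input (I : Instance) : State where
  var x := if x = 0 then I.n else if x = 1 then I.m else if x = 2 then I.k else 0
  arr a i :=
    if a = 0 then
      if h : i / I.m < I.n ∧ i % I.m < I.m then (I.u ⟨i / I.m, h.1⟩ ⟨i % I.m, h.2⟩ : ℕ) else 0
    else 0

/-- The state `s` holds the instance `J` as output, in the same format. -/
def State.Outputs (s : State) (J : Instance) : Prop :=
  s.var 0 = J.n ∧ s.var 1 = J.m ∧ s.var 2 = J.k ∧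
  ∀ (a : Fin J.n) (h : Fin J.m), s.arr 0 ((a : ℕ) * J.m + (h : ℕ)) = (J.u a h : ℕ)

/-- A map on instances is computable in polynomial time: one program computes it on every
instance, in a number of steps bounded by a polynomial in the size of the instance. -/
def PolyTime (f : Instance → Instance) : Prop :=
  ∃ (p : Prog) (b : Polynomial ℕ), ∀ I : Instance, ∃ (t : ℕ) (s : State),
    Exec p I.input t s ∧ t ≤ b.eval I.size ∧ s.Outputs (f I)

/-- `f` is a polynomial kernelization of the problem `Q` parameterized by the number of agents:
it is computable in polynomial time, maps every instance to an equivalent one, and the size of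
the output together with its parameter is at most a polynomial in the input's number of
agents. -/
def IsPolyKernelization (Q : Instance → Prop) (f : Instance → Instance) : Prop :=
  PolyTime f ∧ (∀ I, Q I ↔ Q (f I)) ∧
  ∃ b : Polynomial ℕ, ∀ I : Instance, (f I).size + (f I).n ≤ b.eval I.n

end HouseAllocation

/-! Safety. If `Rule1` applies, giving everyone a dummy house removes all envy. For `Rule2`, an
allocation of the smaller instance extends by giving each agent of `X` its house in the expansion:
these agents are content, and nobody outside `X` values those houses. Conversely, an allocation of
the larger instance can be rearranged (`exists_avoiding`) so that agents outside `X` leave the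
eliminated houses and take houses that `X` frees; they lose nothing they value, and no new house
comes into use, so no envy among them is created.

Exhaustion. A matching auction finds a single application of `Rule2` after which no other is
possible. An unassigned house bids for an agent of smallest label among those valuing it; that label
rises by one and the previous owner of the agent must bid again. A house gives up once all its
labels are at least `n + 1`. At the end, an agent with label `l > 0` is owned by a house all of
whose valuers have label at least `l - 1` (`Labelling.tight`). Let `t` be the smallest label that no
non-dummy agent has; by pigeonhole `t ≤ n`. The houses owning agents with label above `t` are valued
only by such agents, since their valuers have label at least `t` and not `t` (`Labelling.rule2`).
After eliminating these pairs, every remaining non-dummy house is valued below the cap, hence owns a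
remaining agent; if `t > 0`, some non-dummy agent of label zero is unowned and survives. So there
are fewer non-dummy houses than non-dummy agents, or, if `t = 0`, no non-dummy house at all
(`Labelling.restrict_small`). Either way `Rule2` is blocked.

Size. The same analysis applied to an arbitrary reduced instance yields this inequality
(`card_of_not_rule2`); with fewer than `n'` dummy houses it gives the bound on `m'`.

Running time. Each bid raises a label, and labels are at most `n + 1`, so the auction makes
polynomially many rounds. A small program logic (`Runs`) verifies the machine code and its running
time together. -/

namespace HouseAllocation

/-! ### A program logic with running times -/

/-- A bound on the running time of a program in which every loop takes at most `X` rounds. -/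
noncomputable def Prog.timePoly : Prog → Polynomial ℕ
  | .skip => 1
  | .assign _ e => ((e.cost + 1 : ℕ) : Polynomial ℕ)
  | .put _ i e => ((i.cost + e.cost + 1 : ℕ) : Polynomial ℕ)
  | .seq p q => p.timePoly + q.timePoly
  | .ite e p q => ((e.cost + 1 : ℕ) : Polynomial ℕ) + p.timePoly + q.timePoly
  | .loop e p => Polynomial.X * (((e.cost + 1 : ℕ) : Polynomial ℕ) + p.timePoly) +
      ((e.cost + 1 : ℕ) : Polynomial ℕ)

/-- The variables that a program may change. -/
def Prog.vars : Prog → List ℕ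
  | .skip => []
  | .assign x _ => [x]
  | .put _ _ _ => []
  | .seq p q => p.vars ++ q.vars
  | .ite _ p q => p.vars ++ q.vars
  | .loop _ p => p.vars

/-- The arrays that a program may change. -/
def Prog.arrs : Prog → List ℕ
  | .skip => []
  | .assign _ _ => []
  | .put a _ _ => [a]
  | .seq p q => p.arrs ++ q.arrs
  | .ite _ p q => p.arrs ++ q.arrs
  | .loop _ p => p.arrs

@[simp] theorem State.setVar_var (s : State) (x v y : ℕ) :
    (s.setVar x v).var y = if y = x then v else s.var y := by
  simp [State.setVar, Function.update_apply]

@[simp] theorem State.setVar_arr (s : State) (x v : ℕ) : (s.setVar x v).arr = s.arr := rfl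

@[simp] theorem State.setArr_var (s : State) (a i v : ℕ) : (s.setArr a i v).var = s.var := rfl

@[simp] theorem State.setArr_arr (s : State) (a i v b : ℕ) :
    (s.setArr a i v).arr b = if b = a then Function.update (s.arr a) i v else s.arr b := by
  simp [State.setArr, Function.update_apply]

/-- The states `s` and `s'` agree on the memory that the program `p` cannot change. -/
structure Frame (p : Prog) (s s' : State) : Prop where
  var : ∀ x, x ∉ p.vars → s'.var x = s.var x
  arr : ∀ a, a ∉ p.arrs → s'.arr a = s.arr a

/-- Which memory a program may change is syntactic, so invariants need to mention only what changes;
the side conditions for concrete programs are closed by `decide`. -/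
theorem Exec.frame {p : Prog} {s s' : State} {t : ℕ} (h : Exec p s t s') : Frame p s s' := by
  induction h with
  | skip s => exact ⟨fun _ _ => rfl, fun _ _ => rfl⟩
  | assign s x e =>
    refine ⟨fun y hy => ?_, fun _ _ => rfl⟩
    simp only [Prog.vars, List.mem_singleton] at hy
    simp [hy]
  | put s a i e =>
    refine ⟨fun _ _ => rfl, fun b hb => ?_⟩
    simp only [Prog.arrs, List.mem_singleton] at hb
    simp [hb]
  | seq _ _ h₁ h₂ =>
    refine ⟨fun x hx => ?_, fun x hx => ?_⟩
    · simp only [Prog.vars, List.mem_append, not_or] at hx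
      rw [h₂.var x hx.2, h₁.var x hx.1]
    · simp only [Prog.arrs, List.mem_append, not_or] at hx
      rw [h₂.arr x hx.2, h₁.arr x hx.1]
  | ite_true _ _ h =>
    refine ⟨fun x hx => h.var x fun h' => hx ?_, fun x hx => h.arr x fun h' => hx ?_⟩
    · simp [Prog.vars, h']
    · simp [Prog.arrs, h']
  | ite_false _ _ h =>
    refine ⟨fun x hx => h.var x fun h' => hx ?_, fun x hx => h.arr x fun h' => hx ?_⟩
    · simp [Prog.vars, h']
    · simp [Prog.arrs, h']
  | loop_stop _ => exact ⟨fun _ _ => rfl, fun _ _ => rfl⟩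
  | loop_step _ _ _ h₁ h₂ =>
    exact ⟨fun x hx => (h₂.var x hx).trans (h₁.var x hx),
      fun x hx => (h₂.arr x hx).trans (h₁.arr x hx)⟩

/-- Started in `s`, the program `p` halts in a state satisfying `Q`, within the time that its
`timePoly` allows if loops take at most `N` rounds. -/
def Runs (N : ℕ) (p : Prog) (s : State) (Q : State → Prop) : Prop :=
  ∃ t s', Exec p s t s' ∧ t ≤ p.timePoly.eval N ∧ Q s'

namespace Runs

variable {N : ℕ} {p q : Prog} {e : Exp} {s : State} {Q R : State → Prop}

/-- The weakening may use the frame of the run, so postconditions need not repeat what stays fixed.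
-/
theorem mono (h : Runs N p s R) (hQ : ∀ s', Frame p s s' → R s' → Q s') : Runs N p s Q := by
  obtain ⟨t, s', h₁, h₂, h₃⟩ := h
  exact ⟨t, s', h₁, h₂, hQ s' h₁.frame h₃⟩

theorem skip (h : Q s) : Runs N .skip s Q := ⟨1, s, .skip s, by simp [Prog.timePoly], h⟩

theorem assign {x : ℕ} (h : Q (s.setVar x (e.eval s))) : Runs N (.assign x e) s Q :=
  ⟨_, _, .assign s x e, by simp [Prog.timePoly], h⟩

theorem put {a : ℕ} {i : Exp} (h : Q (s.setArr a (i.eval s) (e.eval s))) :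
    Runs N (.put a i e) s Q :=
  ⟨_, _, .put s a i e, by simp [Prog.timePoly], h⟩

theorem seq (h : Runs N p s fun s' => Runs N q s' Q) : Runs N (.seq p q) s Q := by
  obtain ⟨t, s', h₁, h₂, t', s'', h₃, h₄, h₅⟩ := h
  exact ⟨_, _, .seq h₁ h₃, by simpa [Prog.timePoly] using add_le_add h₂ h₄, h₅⟩

theorem ite (h₁ : e.eval s ≠ 0 → Runs N p s Q) (h₂ : e.eval s = 0 → Runs N q s Q) :
    Runs N (.ite e p q) s Q := by
  by_cases h : e.eval s = 0
  · obtain ⟨t, s', h₃, h₄, h₅⟩ := h₂ h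
    refine ⟨_, _, .ite_false h h₃, ?_, h₅⟩
    simp only [Prog.timePoly, Polynomial.eval_add, Polynomial.eval_natCast, Nat.cast_id]
    omega
  · obtain ⟨t, s', h₃, h₄, h₅⟩ := h₁ h
    refine ⟨_, _, .ite_true h h₃, ?_, h₅⟩
    simp only [Prog.timePoly, Polynomial.eval_add, Polynomial.eval_natCast, Nat.cast_id]
    omega

theorem loop_aux (Inv : State → Prop) (V : State → ℕ)
    (step : ∀ s, Inv s → e.eval s ≠ 0 → Runs N p s fun s' => Inv s' ∧ V s' < V s) (n : ℕ) :
    ∀ s, Inv s → V s ≤ n → ∃ t s', Exec (.loop e p) s t s' ∧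
      t ≤ n * ((e.cost + 1) + p.timePoly.eval N) + (e.cost + 1) ∧ Inv s' ∧ e.eval s' = 0 := by
  induction n with
  | zero =>
    intro s hs hV
    -- Another round would push the variant below zero.
    have h : e.eval s = 0 := by
      by_contra h
      obtain ⟨_, _, _, _, _, h'⟩ := step s hs h
      omega
    exact ⟨_, s, Exec.loop_stop h, by simp, hs, h⟩
  | succ n ih =>
    intro s hs hV
    by_cases h : e.eval s = 0
    · exact ⟨_, s, Exec.loop_stop h, by omega, hs, h⟩
    · obtain ⟨t₁, s₁, h₁, h₂, h₃, h₄⟩ := step s hs h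
      obtain ⟨t₂, s₂, h₅, h₆, h₇⟩ := ih s₁ h₃ (by omega)
      refine ⟨_, s₂, .loop_step h h₁ h₅, ?_, h₇⟩
      rw [Nat.succ_mul]
      omega

theorem loop (Inv : State → Prop) (V : State → ℕ) (h0 : Inv s) (hV : V s ≤ N)
    (step : ∀ s', Frame p s s' → Inv s' → e.eval s' ≠ 0 →
      Runs N p s' fun s'' => Inv s'' ∧ V s'' < V s')
    (post : ∀ s', Frame p s s' → Inv s' → e.eval s' = 0 → Q s') :
    Runs N (.loop e p) s Q := by
  -- The frame relative to the initial state is carried along as part of the invariant.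
  obtain ⟨t, s', h₁, h₂, h₃, h₄⟩ := loop_aux (N := N) (p := p) (e := e)
    (fun s' => Frame p s s' ∧ Inv s') V (fun s' hs' he => (step s' hs'.1 hs'.2 he).mono
      fun s'' hf h => ⟨⟨⟨fun x hx => (hf.var x hx).trans (hs'.1.var x hx),
        fun x hx => (hf.arr x hx).trans (hs'.1.arr x hx)⟩, h.1⟩, h.2⟩) N s
    ⟨⟨fun _ _ => rfl, fun _ _ => rfl⟩, h0⟩ hV
  refine ⟨t, s', h₁, ?_, post s' h₃.1 h₃.2 h₄⟩
  simpa [Prog.timePoly] using h₂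

end Runs

/-- Run `p` for the values `0, 1, …` of the variable `x` that are below the variable `b`. -/
def Prog.upTo (x b : ℕ) (p : Prog) : Prog :=
  .seq (.assign x (.const 0))
    (.loop (.sub (.var b) (.var x)) (.seq p (.assign x (.add (.var x) (.const 1)))))

/-- The invariant is indexed by the counter. The body must establish the next instance for the state
after the increment, whence the `setVar` in `step`. -/
theorem Runs.upTo {N x b : ℕ} {p : Prog} {s : State} {Q : State → Prop}
    (Inv : ℕ → State → Prop) (hN : s.var b ≤ N) (hx : x ∉ p.vars) (hb : b ∉ p.vars) (hxb : b ≠ x)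
    (h0 : Inv 0 (s.setVar x 0))
    (step : ∀ i < s.var b, ∀ s', Frame (.upTo x b p) s s' → s'.var x = i → Inv i s' →
      Runs N p s' fun s'' => Inv (i + 1) (s''.setVar x (i + 1)))
    (post : ∀ s', Frame (.upTo x b p) s s' → Inv (s.var b) s' → Q s') :
    Runs N (.upTo x b p) s Q := by
  refine .seq (.assign ?_)
  -- The loop exits when a truncated difference vanishes, which says only that the counter is at
  -- least the bound; the invariant supplies the other inequality.
  refine .loop (fun s' => Inv (s'.var x) s' ∧ s'.var x ≤ s.var b) (fun s' => s.var b - s'.var x)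
    (by simpa [Exp.eval] using h0) (by simpa [Exp.eval] using hN) ?_ ?_
  · intro s' hf ⟨hs', hle⟩ he
    have hb' : s'.var b = s.var b := by
      rw [hf.var b (by simp [Prog.vars, hb, hxb])]; simp [hxb]
    have hlt : s'.var x < s.var b := by
      simp only [Exp.eval, hb'] at he; omega
    refine .seq ((step _ hlt s' ⟨fun y hy => ?_, fun y hy => ?_⟩ rfl hs').mono
      fun s'' hf' hs'' => .assign ?_)
    · simp only [Prog.upTo, Prog.vars, List.mem_append, List.mem_singleton, not_or] at hy
      rw [hf.var y (by simp [Prog.vars, hy])]; simp [hy]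
    · simp only [Prog.upTo, Prog.arrs, List.mem_append, not_or] at hy
      rw [hf.arr y (by simp [Prog.arrs, hy])]; rfl
    · have := hf'.var x hx
      simp only [Exp.eval, this]
      exact ⟨⟨by simpa using hs'', by simp; omega⟩, by simp; omega⟩
  · intro s' hf ⟨hs', hle⟩ he
    have hb' : s'.var b = s.var b := by
      rw [hf.var b (by simp [Prog.vars, hb, hxb])]; simp [hxb]
    have : s'.var x = s.var b := by
      simp only [Exp.eval, hb'] at he; omega
    rw [this] at hs'
    refine post s' ⟨fun y hy => ?_, fun y hy => ?_⟩ hs'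
    · simp only [Prog.upTo, Prog.vars, List.mem_append, List.mem_singleton, not_or] at hy
      rw [hf.var y (by simp [Prog.vars, hy])]; simp [hy]
    · simp only [Prog.upTo, Prog.arrs, List.mem_append, not_or] at hy
      rw [hf.arr y (by simp [Prog.arrs, hy])]; rfl

/-- Count in the variable `c` the values of the variable `3` below the variable `b` for which
`e` is nonzero. -/
def Prog.count (c b : ℕ) (e : Exp) : Prog :=
  .seq (.assign c (.const 0)) (.upTo 3 b (.ite e (.assign c (.add (.var c) (.const 1))) .skip))

theorem Runs.count {N c b : ℕ} {e : Exp} {s : State} {Q : State → Prop} (P : ℕ → Prop)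
    [DecidablePred P] (hN : s.var b ≤ N) (hc : c ≠ 3) (hb : b ≠ 3) (hbc : b ≠ c)
    (he : ∀ i < s.var b, ∀ s', Frame (.count c b e) s s' → s'.var 3 = i → (e.eval s' ≠ 0 ↔ P i))
    (post : ∀ s', Frame (.count c b e) s s' → s'.var c = Nat.count P (s.var b) → Q s') :
    Runs N (.count c b e) s Q := by
  have hb' : (s.setVar c 0).var b = s.var b := by simp [hbc]
  have hframe : ∀ {s'}, Frame (.upTo 3 b (.ite e (.assign c (.add (.var c) (.const 1))) .skip))
      (s.setVar c 0) s' → Frame (.count c b e) s s' := by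
    intro s' hf
    refine ⟨fun y hy => ?_, fun y hy => ?_⟩
    · simp only [Prog.count, Prog.vars, List.mem_append, List.mem_singleton, not_or] at hy
      rw [hf.var y hy.2]; simp [hy]
    · simp only [Prog.count, Prog.arrs, List.mem_append, not_or] at hy
      rw [hf.arr y hy.2]; rfl
  refine .seq (.assign (.upTo (fun i s' => s'.var c = Nat.count P i) ?_ ?_ ?_ hb ?_ ?_ ?_))
  · simpa [Exp.eval, hbc] using hN
  · simp [Prog.vars, hc.symm]
  · simp [Prog.vars, hbc]
  · simp [Exp.eval, hc]
  · intro i hi s' hf h3 hs'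
    have := he i (by rwa [Exp.eval, hb'] at hi) s' (hframe hf) h3
    refine .ite (fun h => .assign ?_) (fun h => .skip ?_)
    · simp [hc, Exp.eval, hs', Nat.count_succ, this.1 h]
    · have h' : ¬ P i := fun h' => this.2 h' h
      simp [hc, hs', Nat.count_succ, h']
  · intro s' hf hs'
    exact post s' (hframe hf) (by rwa [Exp.eval, hb'] at hs')

/-! ### Safety of the two reduction rules -/

namespace Instance

variable {I J : Instance}

theorem not_values {a : Fin I.n} {h : Fin I.m} : ¬ I.Values a h ↔ I.u a h = 0 := by
  unfold Values; omega

theorem envies_iff {Φ : I.Allocation} {a b : Fin I.n} :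
    I.Envies Φ a b ↔ ¬ I.Values a (Φ a) ∧ I.Values a (Φ b) := by
  unfold Envies Values; omega

@[simp] theorem mem_dummyHouses {h : Fin I.m} : h ∈ I.dummyHouses ↔ ∀ a, ¬ I.Values a h := by
  simp [dummyHouses, IsDummyHouse, not_values]

@[simp] theorem mem_dummyAgents {a : Fin I.n} : a ∈ I.dummyAgents ↔ ∀ h, ¬ I.Values a h := by
  simp [dummyAgents, IsDummyAgent, not_values]

theorem envy_eq_zero_of_values {Φ : I.Allocation} {a : Fin I.n} (h : I.Values a (Φ a)) :
    I.envy Φ a = 0 := by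
  simp [envy, envies_iff, h]

/-- All three problems are solved at once by an allocation without envy. -/
theorem yes_of_envy_eq_zero (Φ : I.Allocation) (h : ∀ a, I.envy Φ a = 0) :
    I.OHA ∧ I.EHA ∧ I.UHA :=
  ⟨⟨Φ, by simp [numEnvious, h]⟩, ⟨Φ, by simp [maxEnvy, h]⟩, ⟨Φ, by simp [totalEnvy, h]⟩⟩

theorem yes_of_rule1 (h : I.Rule1) : I.OHA ∧ I.EHA ∧ I.UHA := by
  have hc : Fintype.card (Fin I.n) ≤ Fintype.card I.dummyHouses := by
    simpa [Rule1] using h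
  obtain ⟨φ⟩ := Function.Embedding.nonempty_of_card_le hc
  refine yes_of_envy_eq_zero (φ.trans (Function.Embedding.subtype _)) fun a => ?_
  have : ∀ b, ¬ I.Values a (φ b) := fun b => mem_dummyHouses.1 (φ b).2 a
  simp [envy, envies_iff, this]

theorem yes_trivialYes (k : ℕ) :
    (trivialYes k).OHA ∧ (trivialYes k).EHA ∧ (trivialYes k).UHA := by
  refine yes_of_envy_eq_zero (I := trivialYes k) (Function.Embedding.refl _) fun a => ?_
  exact envy_eq_zero_of_values (by
    simp [Values, trivialYes]; rfl)

/-- An injection of agents under which envy does not decrease, all other agents being without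
envy, transfers solutions. -/
theorem problems_of_envy_le (hk : J.k = I.k) (α : Fin J.n ↪ Fin I.n) (Φ : I.Allocation)
    (Ψ : J.Allocation) (h : ∀ a, I.envy Φ (α a) ≤ J.envy Ψ a)
    (h0 : ∀ a, a ∉ Set.range α → I.envy Φ a = 0) :
    (J.numEnvious Ψ ≤ J.k → I.OHA) ∧ (J.maxEnvy Ψ ≤ J.k → I.EHA) ∧
      (J.totalEnvy Ψ ≤ J.k → I.UHA) := by
  refine ⟨fun hJ => ⟨Φ, ?_⟩, fun hJ => ⟨Φ, ?_⟩, fun hJ => ⟨Φ, ?_⟩⟩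
  · rw [← hk]
    refine le_trans ?_ hJ
    unfold numEnvious
    rw [← Finset.card_map α]
    refine Finset.card_le_card fun a ha => ?_
    simp only [Finset.mem_filter, Finset.mem_univ, true_and] at ha
    by_cases hr : a ∈ Set.range α
    · obtain ⟨b, rfl⟩ := hr
      exact Finset.mem_map_of_mem _ (by simpa using ha.trans (h b))
    · rw [h0 a hr] at ha; omega
  · rw [← hk]
    refine Finset.sup_le fun a _ => ?_
    by_cases hr : a ∈ Set.range α
    · obtain ⟨b, rfl⟩ := hr
      exact ((h b).trans (Finset.le_sup (f := fun a => J.envy Ψ a) (Finset.mem_univ b))).trans hJ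
    · rw [h0 a hr]; omega
  · rw [← hk]
    refine le_trans ?_ hJ
    unfold totalEnvy
    calc ∑ a, I.envy Φ a = ∑ a ∈ Finset.univ.map α, I.envy Φ a := by
          refine (Finset.sum_subset (Finset.subset_univ _) fun a _ ha => h0 a ?_).symm
          simpa using ha
      _ = ∑ a, I.envy Φ (α a) := by simp
      _ ≤ _ := Finset.sum_le_sum fun a _ => h a

/-- An injection of agents under which envy does not decrease transfers solutions. -/
theorem problems_of_le_envy (hk : J.k = I.k) (α : Fin J.n ↪ Fin I.n) (Φ : I.Allocation)
    (Ψ : J.Allocation) (h : ∀ a, J.envy Ψ a ≤ I.envy Φ (α a)) :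
    (I.numEnvious Φ ≤ I.k → J.OHA) ∧ (I.maxEnvy Φ ≤ I.k → J.EHA) ∧
      (I.totalEnvy Φ ≤ I.k → J.UHA) := by
  refine ⟨fun hJ => ⟨Ψ, ?_⟩, fun hJ => ⟨Ψ, ?_⟩, fun hJ => ⟨Ψ, ?_⟩⟩
  · rw [hk]
    refine le_trans ?_ hJ
    unfold numEnvious
    rw [← Finset.card_map α]
    refine Finset.card_le_card fun a ha => ?_
    simp only [Finset.mem_map, Finset.mem_filter, Finset.mem_univ, true_and] at ha ⊢
    obtain ⟨b, hb, rfl⟩ := ha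
    exact hb.trans (h b)
  · rw [hk]
    exact Finset.sup_le fun a _ =>
      ((h a).trans (Finset.le_sup (f := fun a => I.envy Φ a) (Finset.mem_univ (α a)))).trans hJ
  · rw [hk]
    refine le_trans ?_ hJ
    unfold totalEnvy
    calc ∑ a, J.envy Ψ a ≤ ∑ a, I.envy Φ (α a) := Finset.sum_le_sum fun a _ => h a
      _ = ∑ a ∈ Finset.univ.map α, I.envy Φ a := by simp
      _ ≤ _ := Finset.sum_le_sum_of_subset (Finset.subset_univ _)

/-- An allocation can be changed, without using new houses, so that the agents outside `X` avoid
the houses of `Z`, if there are no more houses in `Z` than agents in `X`. -/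
theorem exists_avoiding (Φ : I.Allocation) (X : Finset (Fin I.n)) (Z : Finset (Fin I.m))
    (hc : Z.card ≤ X.card) :
    ∃ Ψ : {a // a ∉ X} → Fin I.m, Function.Injective Ψ ∧ (∀ a, Ψ a ∉ Z) ∧
      (∀ a : {a // a ∉ X}, Φ a ∉ Z → Ψ a = Φ a) ∧ ∀ a, ∃ b, Ψ a = Φ b := by
  classical
  let B : Finset (Fin I.n) := Xᶜ.filter fun a => Φ a ∈ Z
  let C : Finset (Fin I.n) := X.filter fun a => Φ a ∉ Z
  have hBC : B.card ≤ C.card := by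
    -- All agents counted here occupy distinct houses of `Z`. Removing the agents of `X` that do so
    -- from both sides of `Z.card ≤ X.card` compares the displaced agents `B` with the freed houses
    -- of `C`.
    have h1 : (B ∪ X.filter fun a => Φ a ∈ Z).card ≤ Z.card :=
      Finset.card_le_card_of_injOn Φ (by intro a; simp [B]; tauto) Φ.injective.injOn
    rw [Finset.card_union_of_disjoint] at h1
    · have h2 := Finset.card_filter_add_card_filter_not (s := X) (fun a => Φ a ∈ Z)
      simp only [C]; omega
    · rw [Finset.disjoint_left]; intro a; simp [B]; tauto
  obtain ⟨g⟩ := Function.Embedding.nonempty_of_card_le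
    (show Fintype.card B ≤ Fintype.card C by simpa using hBC)
  have hg : ∀ b, (g b : Fin I.n) ∈ X ∧ Φ (g b) ∉ Z := fun b => by
    have := (g b).2
    simp only [C, Finset.mem_filter] at this
    exact this
  let Ψ : {a // a ∉ X} → Fin I.m := fun a =>
    if h : Φ a ∈ Z then Φ (g ⟨a, by simp [B, h, a.2]⟩) else Φ a
  refine ⟨Ψ, ?_, ?_, ?_, ?_⟩
  · intro a b hab
    by_cases h1 : Φ a ∈ Z <;> by_cases h2 : Φ b ∈ Z <;>
      simp only [Ψ, h1, h2, dite_true, dite_false] at hab <;> have hab := Φ.injective hab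
    · have := g.injective (Subtype.ext hab)
      exact Subtype.ext (by simpa using this)
    · exact absurd (hab ▸ (hg _).1) b.2
    · exact absurd (hab ▸ (hg _).1) a.2
    · exact Subtype.ext hab
  · intro a
    by_cases h1 : Φ a ∈ Z <;> simp only [Ψ, h1, dite_true, dite_false]
    · exact (hg _).2
    · exact not_false
  · intro a h1
    simp only [Ψ, h1, dite_false]
  · intro a
    by_cases h1 : Φ a ∈ Z <;> simp only [Ψ, h1, dite_true, dite_false]
    · exact ⟨_, rfl⟩
    · exact ⟨_, rfl⟩

/-- What an expansion provides: a map that sends the agents of `X` injectively to houses they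
value, onto the saturated houses. -/
theorem IsExpansion.exists_map {X : Finset (Fin I.n)} {Y : Finset (Fin I.m)}
    {M : Finset (Fin I.n × Fin I.m)} (hM : I.IsExpansion X Y M) :
    M.image Prod.fst = X ∧ ∃ f : {a // a ∈ X} → Fin I.m, Function.Injective f ∧
      (∀ h, h ∈ M.image Prod.snd ↔ ∃ a, f a = h) ∧
      ∀ a : {a // a ∈ X}, I.Values a (f a) ∧ f a ∈ Y := by
  obtain ⟨h1, h2, h3⟩ := hM
  refine ⟨?_, ?_⟩
  · ext a
    simp only [Finset.mem_image, Prod.exists, exists_and_right, exists_eq_right]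
    exact ⟨fun ⟨h, hh⟩ => (h1 _ hh).2.1, fun ha => (h2 a ha).exists⟩
  · choose f hf hf' using fun a : {a // a ∈ X} => h2 a a.2
    have himg : M.image Prod.snd = Finset.univ.image f := by
      ext h
      simp only [Finset.mem_image, Prod.exists, exists_eq_right, Finset.mem_univ, true_and]
      constructor
      · rintro ⟨a, ha⟩
        exact ⟨⟨a, (h1 _ ha).2.1⟩, (hf' _ h ha).symm⟩
      · rintro ⟨a, rfl⟩
        exact ⟨a, hf a⟩
    refine ⟨f, ?_, fun h => by simp [himg], fun a => ⟨(h1 _ (hf a)).1, (h1 _ (hf a)).2.2⟩⟩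
    -- Injectivity comes from the third clause of `IsExpansion`: the image of `f` has as many
    -- elements as its domain.
    have : (Finset.univ.image f).card = (Finset.univ : Finset {a // a ∈ X}).card := by
      rw [← himg, h3]; simp
    simpa using Finset.card_image_iff.1 this

theorem Eliminates.card {X : Finset (Fin I.n)} {Z : Finset (Fin I.m)} (h : I.Eliminates J X Z) :
    J.n + X.card = I.n ∧ J.m + Z.card = I.m := by
  obtain ⟨-, α, β, hα, hβ, -⟩ := h
  have h1 : Finset.univ.map α = Xᶜ := by ext a; simpa using hα a
  have h2 : Finset.univ.map β = Zᶜ := by ext a; simpa using hβ a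
  have h1' := congrArg Finset.card h1
  have h2' := congrArg Finset.card h2
  have h3 := Finset.card_le_univ X
  have h4 := Finset.card_le_univ Z
  simp only [Finset.card_map, Finset.card_univ, Fintype.card_fin, Finset.card_compl] at *
  omega

/-- An expansion saturates equally many agents and houses, so the rule preserves the difference
between their numbers. -/
theorem Rule2.card (h : I.Rule2 J) : ∃ c, J.n + c = I.n ∧ J.m + c = I.m := by
  obtain ⟨-, X, Y, M, -, -, -, -, hM, -, hE⟩ := h
  have h1 := hM.2.2
  rw [← hM.exists_map.1] at h1
  refine ⟨_, hE.card.1, ?_⟩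
  rw [← h1]
  exact hE.card.2

/-- The second rule is safe. -/
theorem Rule2.problems_iff (h : I.Rule2 J) :
    (I.OHA ↔ J.OHA) ∧ (I.EHA ↔ J.EHA) ∧ (I.UHA ↔ J.UHA) := by
  classical
  obtain ⟨-, X, Y, M, -, -, -, -, hM, hY, hk, α, β, hα, hβ, hu⟩ := h
  obtain ⟨hX, f, hf, hZ, hfv⟩ := hM.exists_map
  have hcard : (M.image Prod.snd).card = X.card := hM.2.2
  rw [hX] at hα
  generalize M.image Prod.snd = Z at *
  have hval : ∀ a h, J.Values a h ↔ I.Values (α a) (β h) := fun a h => by simp [Values, hu]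
  have hZv : ∀ h ∈ Z, ∀ a, I.Values a h → a ∈ X := by
    intro h hh
    obtain ⟨a, rfl⟩ := (hZ h).1 hh
    exact hY _ (hfv a).2
  have hαX : ∀ a, α a ∉ X := fun a => (hα _).1 ⟨a, rfl⟩
  have hβZ : ∀ h, β h ∉ Z := fun h => (hβ _).1 ⟨h, rfl⟩
  -- Combine `Ψ` outside `X` with the expansion inside `X`.
  have back : ∀ Ψ : J.Allocation, ∃ Φ : I.Allocation, (∀ a, I.envy Φ (α a) ≤ J.envy Ψ a) ∧
      ∀ a, a ∉ Set.range α → I.envy Φ a = 0 := by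
    intro Ψ
    have inv : ∀ a : Fin I.n, ∃ h : Fin I.m, (∀ b, α b = a → h = β (Ψ b)) ∧
        ∀ ha : a ∈ X, h = f ⟨a, ha⟩ := by
      intro a
      by_cases ha : a ∈ X
      · exact ⟨f ⟨a, ha⟩, fun b hb => absurd ha (hb ▸ hαX b), fun _ => rfl⟩
      · obtain ⟨b, rfl⟩ := (hα a).2 ha
        exact ⟨β (Ψ b), fun b' hb' => by rw [α.injective hb'], fun h => absurd h ha⟩
    choose φ h1 h2 using inv
    have hinj : Function.Injective φ := by
      intro a b hab
      by_cases ha : a ∈ X <;> by_cases hb : b ∈ X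
      · rw [h2 a ha, h2 b hb] at hab
        simpa using hf hab
      · obtain ⟨b, rfl⟩ := (hα b).2 hb
        rw [h2 a ha, h1 _ b rfl] at hab
        exact absurd ((hZ _).2 ⟨_, hab⟩) (hβZ _)
      · obtain ⟨a, rfl⟩ := (hα a).2 ha
        rw [h2 b hb, h1 _ a rfl] at hab
        exact absurd ((hZ _).2 ⟨_, hab.symm⟩) (hβZ _)
      · obtain ⟨a, rfl⟩ := (hα a).2 ha
        obtain ⟨b, rfl⟩ := (hα b).2 hb
        rw [h1 _ a rfl, h1 _ b rfl] at hab
        rw [Ψ.injective (β.injective hab)]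
    refine ⟨⟨φ, hinj⟩, fun a => ?_, fun a ha => ?_⟩
    · unfold envy
      rw [← Finset.card_map α]
      refine Finset.card_le_card fun b hb => ?_
      simp only [envies_iff, Finset.mem_filter, Finset.mem_univ, true_and,
        Function.Embedding.coeFn_mk, Finset.mem_map, hval] at hb ⊢
      by_cases hbX : b ∈ X
      · rw [h2 b hbX] at hb
        exact absurd (hZv _ ((hZ _).2 ⟨_, rfl⟩) _ hb.2) (hαX a)
      · obtain ⟨b, rfl⟩ := (hα b).2 hbX
        rw [h1 _ b rfl, h1 _ a rfl] at hb
        exact ⟨b, hb, rfl⟩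
    · have ha' : a ∈ X := by
        by_contra h; exact ha ((hα a).2 h)
      refine envy_eq_zero_of_values ?_
      simp only [Function.Embedding.coeFn_mk]
      rw [h2 a ha']
      exact (hfv ⟨a, ha'⟩ :).1
  -- Rearrange `Φ` to avoid `Z`. Whoever is envied after this holds a house that some agent `g b`
  -- held under `Φ`, so envied agents inject into agents envied before.
  have forth : ∀ Φ : I.Allocation, ∃ Ψ : J.Allocation, ∀ a, J.envy Ψ a ≤ I.envy Φ (α a) := by
    intro Φ
    obtain ⟨φ, h1, h2, h3, h4⟩ := I.exists_avoiding Φ X Z hcard.le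
    choose ψ hψ using fun a : Fin J.n => (hβ (φ ⟨α a, hαX a⟩)).2 (h2 _)
    have hinj : Function.Injective ψ := by
      intro a b hab
      have := congrArg β hab
      rw [hψ, hψ] at this
      simpa using h1 this
    choose g hg using h4
    refine ⟨⟨ψ, hinj⟩, fun a => ?_⟩
    unfold envy
    refine Finset.card_le_card_of_injOn (fun b => g ⟨α b, hαX b⟩) (fun b hb => ?_) ?_
    · simp only [envies_iff, Finset.coe_filter, Finset.mem_univ, true_and, Set.mem_ofPred_eq,
        Function.Embedding.coeFn_mk, hval, hψ] at hb ⊢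
      refine ⟨fun hv => hb.1 ?_, by rw [← hg]; exact hb.2⟩
      -- If `a` valued its old house, that house would not lie in `Z`, as no agent outside `X`
      -- values a house of `Z`; hence `a` would have kept it.
      rw [h3]
      · exact hv
      · exact fun hz => hαX a (hZv _ hz _ hv)
    · intro b _ c _ hbc
      have : φ ⟨α b, hαX b⟩ = φ ⟨α c, hαX c⟩ := by
        rw [hg, hg]; exact congrArg Φ hbc
      simpa using h1 this
  refine ⟨⟨?_, ?_⟩, ⟨?_, ?_⟩, ⟨?_, ?_⟩⟩ <;> rintro ⟨Φ, hΦ⟩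
  · obtain ⟨Ψ, h⟩ := forth Φ; exact (problems_of_le_envy hk α Φ Ψ h).1 hΦ
  · obtain ⟨Ψ, h, h'⟩ := back Φ; exact (problems_of_envy_le hk α Ψ Φ h h').1 hΦ
  · obtain ⟨Ψ, h⟩ := forth Φ; exact (problems_of_le_envy hk α Φ Ψ h).2.1 hΦ
  · obtain ⟨Ψ, h, h'⟩ := back Φ; exact (problems_of_envy_le hk α Ψ Φ h h').2.1 hΦ
  · obtain ⟨Ψ, h⟩ := forth Φ; exact (problems_of_le_envy hk α Φ Ψ h).2.2 hΦ
  · obtain ⟨Ψ, h, h'⟩ := back Φ; exact (problems_of_envy_le hk α Ψ Φ h h').2.2 hΦ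

/-! ### Restricting an instance to sets of agents and houses -/

/-- The edges of the preference graph, for natural numbers. -/
def Edge (I : Instance) (a h : ℕ) : Prop :=
  ∃ (ha : a < I.n) (hh : h < I.m), I.Values ⟨a, ha⟩ ⟨h, hh⟩

theorem edge_iff {a : Fin I.n} {h : Fin I.m} : I.Edge a h ↔ I.Values a h := by
  simp [Edge]

theorem ext_of_values {I J : Instance} (hn : I.n = J.n) (hm : I.m = J.m) (hk : I.k = J.k)
    (hu : ∀ (a : Fin I.n) (h : Fin I.m), I.u a h = J.u (a.cast hn) (h.cast hm)) : I = J := by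
  obtain ⟨n, m, u, k⟩ := I
  obtain ⟨n', m', u', k'⟩ := J
  dsimp only at hn hm hk
  subst hn hm hk
  congr
  funext a h
  exact hu a h

/-- The instance that consists of the agents in `p` and the houses in `q`, in their order. -/
noncomputable def restrict (I : Instance) (p q : ℕ → Prop) [DecidablePred p] [DecidablePred q] :
    Instance where
  n := Nat.count p I.n
  m := Nat.count q I.m
  u a h := I.u ⟨Nat.nth p a, Nat.nth_lt_of_lt_count a.2⟩ ⟨Nat.nth q h, Nat.nth_lt_of_lt_count h.2⟩
  k := I.k

theorem nth_injOn_count (p : ℕ → Prop) [DecidablePred p] (n : ℕ) {i j : ℕ}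
    (hi : i < Nat.count p n) (hj : j < Nat.count p n) (h : Nat.nth p i = Nat.nth p j) : i = j := by
  rw [← Nat.count_nth (p := p) (n := i), ← Nat.count_nth (p := p) (n := j), h]
  · exact fun hf => hj.trans_le (Nat.count_le_card hf n)
  · exact fun hf => hi.trans_le (Nat.count_le_card hf n)

theorem nth_mem_of_lt_count {p : ℕ → Prop} [DecidablePred p] {n i : ℕ}
    (hi : i < Nat.count p n) : p (Nat.nth p i) :=
  Nat.nth_mem i fun hf => hi.trans_le (Nat.count_le_card hf n)

theorem count_lt_count_of_lt {p : ℕ → Prop} [DecidablePred p] {i n : ℕ} (h : i < n) (hp : p i) :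
    Nat.count p i < Nat.count p n :=
  (Nat.count_lt_count_succ_iff.2 hp).trans_le (Nat.count_monotone p h)

section restrict

variable (p q : ℕ → Prop) [DecidablePred p] [DecidablePred q]

/-- The agents of a restriction, as agents of the original instance. -/
noncomputable def restrictAgent : Fin (I.restrict p q).n ↪ Fin I.n where
  toFun a := ⟨Nat.nth p a, Nat.nth_lt_of_lt_count a.2⟩
  inj' a b hab := Fin.ext (nth_injOn_count p I.n a.2 b.2 (by simpa using hab))

/-- The houses of a restriction, as houses of the original instance. -/
noncomputable def restrictHouse : Fin (I.restrict p q).m ↪ Fin I.m where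
  toFun a := ⟨Nat.nth q a, Nat.nth_lt_of_lt_count a.2⟩
  inj' a b hab := Fin.ext (nth_injOn_count q I.m a.2 b.2 (by simpa using hab))

theorem mem_range_restrictAgent (a : Fin I.n) :
    a ∈ Set.range (I.restrictAgent p q) ↔ p a := by
  constructor
  · rintro ⟨b, rfl⟩
    exact nth_mem_of_lt_count b.2
  · intro ha
    exact ⟨⟨Nat.count p a, count_lt_count_of_lt a.2 ha⟩, Fin.ext (Nat.nth_count ha)⟩

theorem mem_range_restrictHouse (h : Fin I.m) :
    h ∈ Set.range (I.restrictHouse p q) ↔ q h := by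
  constructor
  · rintro ⟨b, rfl⟩
    exact nth_mem_of_lt_count b.2
  · intro ha
    exact ⟨⟨Nat.count q h, count_lt_count_of_lt h.2 ha⟩, Fin.ext (Nat.nth_count ha)⟩

theorem restrict_values {a : Fin (I.restrict p q).n} {h : Fin (I.restrict p q).m} :
    (I.restrict p q).Values a h ↔ I.Values (I.restrictAgent p q a) (I.restrictHouse p q h) :=
  Iff.rfl

/-- With this, the case without any elimination is also an instance of `restrict`, and one output
routine serves both. -/
theorem restrict_eq_self (hp : ∀ a < I.n, p a) (hq : ∀ h < I.m, q h) : I.restrict p q = I := by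
  refine ext_of_values (Nat.count_of_forall fun {a} ha => hp a ha)
    (Nat.count_of_forall fun {a} ha => hq a ha) rfl fun a h => ?_
  have ha : (a : ℕ) < I.n := Nat.count_of_forall (p := p) (fun {a} ha => hp a ha) ▸ a.2
  have hh : (h : ℕ) < I.m := Nat.count_of_forall (p := q) (fun {a} ha => hq a ha) ▸ h.2
  have h1 : Nat.nth p a = a := Nat.nth_of_forall fun n hn => hp n (by omega)
  have h2 : Nat.nth q h = h := Nat.nth_of_forall fun n hn => hq n (by omega)
  simp only [restrict]
  congr 1
  · exact Fin.ext h1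
  · exact Fin.ext h2

end restrict

theorem not_rule2 (h : I.dummyHousesᶜ.card < I.dummyAgentsᶜ.card ∨ I.dummyHousesᶜ = ∅)
    (J : Instance) : ¬ I.Rule2 J := by
  rintro ⟨h1, X, Y, M, -, hY, -, hne, -⟩
  rcases h with h | h
  · omega
  · rw [h] at hY
    exact hne.ne_empty (Finset.subset_empty.1 hY)

end Instance

/-! ### Auction labellings and the threshold -/

/-- The state of an auction in which houses bid for agents: agent `a` has the label `d a` and
belongs to the house `h` if `o a = h + 1`, to no house if `o a = 0`. The houses below `p` took
part so far; the house `c - 1` is bidding if `c ≠ 0`. -/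
structure Labelling (n m : ℕ) (E : ℕ → ℕ → Prop) (d o : ℕ → ℕ) (p c : ℕ) : Prop where
  zero_iff : ∀ a < n, d a = 0 ↔ o a = 0
  edge : ∀ a < n, ∀ h, o a = h + 1 → h < m ∧ E a h
  inj : ∀ a < n, ∀ b < n, o a ≠ 0 → o a = o b → a = b
  ne_cur : ∀ a < n, o a ≠ 0 → o a ≠ c
  le : ∀ a < n, d a ≤ n + 1
  tight : ∀ a < n, ∀ h, o a = h + 1 → ∀ b < n, E b h → d a ≤ d b + 1
  done : ∀ h < p, h + 1 ≠ c → (∃ a < n, o a = h + 1) ∨ ∀ b < n, E b h → n + 1 ≤ d b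
  owner_le : ∀ a < n, o a ≤ p
  cur_le : c ≤ p

namespace Labelling

variable {n m p c : ℕ} {E : ℕ → ℕ → Prop} {d o : ℕ → ℕ}

theorem init (n m : ℕ) (E : ℕ → ℕ → Prop) : Labelling n m E (fun _ => 0) (fun _ => 0) 0 0 := by
  constructor <;> simp

theorem next (L : Labelling n m E d o p 0) : Labelling n m E d o (p + 1) (p + 1) where
  zero_iff := L.zero_iff
  edge := L.edge
  inj := L.inj
  ne_cur a ha _ := by have := L.owner_le a ha; omega
  le := L.le
  tight := L.tight
  done h hh hc := L.done h (by omega) (by omega)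
  owner_le a ha := by have := L.owner_le a ha; omega
  cur_le := le_rfl

theorem giveUp (L : Labelling n m E d o p c) (hc : ∀ b < n, E b (c - 1) → n + 1 ≤ d b) :
    Labelling n m E d o p 0 where
  zero_iff := L.zero_iff
  edge := L.edge
  inj := L.inj
  ne_cur a ha h := h
  le := L.le
  tight := L.tight
  done h hh _ := by
    by_cases hc' : h + 1 = c
    · subst hc'; exact .inr hc
    · exact L.done h hh hc'
  owner_le := L.owner_le
  cur_le := Nat.zero_le _

/-- Since `a` has a minimal label, its new label is at most one above those of the other valuers;
elsewhere tightness survives because labels only grow. The displaced house `o a - 1`, if any,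
becomes the bidder, and `o a = 0` means that nobody bids. -/
theorem bid (L : Labelling n m E d o p c) (hc : c ≠ 0) (hcm : c ≤ m) {a : ℕ} (ha : a < n)
    (hE : E a (c - 1)) (hd : d a ≤ n) (hmin : ∀ b < n, E b (c - 1) → d a ≤ d b) :
    Labelling n m E (Function.update d a (d a + 1)) (Function.update o a c) p (o a) := by
  have mono : ∀ b, d b ≤ Function.update d a (d a + 1) b := by
    intro b; by_cases h : b = a
    · subst h; simp
    · simp [h]
  refine ⟨?_, ?_, ?_, ?_, ?_, ?_, ?_, ?_, L.owner_le a ha⟩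
  · intro b hb
    by_cases h : b = a
    · subst h; simp [hc]
    · simpa [h] using L.zero_iff b hb
  · intro b hb h
    by_cases h' : b = a
    · subst h'
      simp only [Function.update_self]
      rintro rfl
      exact ⟨by omega, by simpa using hE⟩
    · simpa [h'] using L.edge b hb h
  · intro b hb b' hb'
    by_cases h : b = a <;> by_cases h' : b' = a
    · rw [h, h']; simp
    · subst h
      simp only [Function.update_self, ne_eq, h', not_false_eq_true, Function.update_of_ne]
      intro _ h2
      exact absurd h2.symm (L.ne_cur b' hb' (by omega))
    · subst h'
      simp only [Function.update_self, ne_eq, h, not_false_eq_true, Function.update_of_ne]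
      intro h1 h2
      exact absurd h2 (L.ne_cur b hb h1)
    · simpa [h, h'] using L.inj b hb b' hb'
  · intro b hb
    by_cases h : b = a
    · subst h
      simp only [Function.update_self]
      intro _ h2
      exact L.ne_cur b hb (by omega) h2.symm
    · simp only [ne_eq, h, not_false_eq_true, Function.update_of_ne]
      intro h1 h2
      exact h (L.inj b hb a ha h1 h2)
  · intro b hb
    by_cases h : b = a
    · subst h; simpa using hd
    · simpa [h] using L.le b hb
  · intro b hb h
    by_cases h' : b = a
    · subst h'
      simp only [Function.update_self]
      rintro rfl b' hb' hE'
      have := hmin b' hb' (by simpa using hE')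
      have := mono b'
      omega
    · simp only [ne_eq, h', not_false_eq_true, Function.update_of_ne]
      intro h1 b' hb' hE'
      have := L.tight b hb h h1 b' hb' hE'
      have := mono b'
      omega
  · intro h hh hne
    by_cases h1 : h + 1 = c
    · exact .inl ⟨a, ha, by simp [h1]⟩
    · rcases L.done h hh h1 with ⟨b, hb, h2⟩ | h2
      · refine .inl ⟨b, hb, ?_⟩
        have : b ≠ a := by rintro rfl; exact hne h2.symm
        simpa [this] using h2
      · exact .inr fun b hb hE' => (h2 b hb hE').trans (mono b)
  · intro b hb
    by_cases h : b = a
    · subst h; simpa using L.cur_le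
    · simpa [h] using L.owner_le b hb

end Labelling

/-- The threshold `t` for the labels: the smallest label that no non-dummy agent has if the
second rule's counting condition holds, and otherwise a number above all labels but one. -/
def IsThreshold (I : Instance) (d : ℕ → ℕ) (t : ℕ) : Prop :=
  (I.dummyHousesᶜ.card < I.dummyAgentsᶜ.card ∧ t = I.n + 1) ∨
  (I.dummyAgentsᶜ.card ≤ I.dummyHousesᶜ.card ∧ t ≤ I.n ∧
    (∀ i < t, ∃ a < I.n, (∃ h < I.m, I.Edge a h) ∧ d a = i) ∧
    ¬ ∃ a < I.n, (∃ h < I.m, I.Edge a h) ∧ d a = t)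

namespace Labelling

open Instance

variable {I : Instance} {d o : ℕ → ℕ} {t : ℕ}

/-- The agents above the threshold have positive labels, so they are owned; the owning houses form
the expansion. Closure under valuers comes from tightness and the gap at `t`. -/
theorem rule2 (L : Labelling I.n I.m I.Edge d o I.m 0)
    (hle : I.dummyAgentsᶜ.card ≤ I.dummyHousesᶜ.card)
    (hgap : ¬ ∃ a < I.n, (∃ h < I.m, I.Edge a h) ∧ d a = t) (q : ℕ → Prop) [DecidablePred q]
    (hq : ∀ h, q h ↔ ¬ ∃ a < I.n, t < d a ∧ o a = h + 1) (hX : ∃ a < I.n, t < d a) :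
    I.Rule2 (I.restrict (fun a => d a ≤ t) q) := by
  classical
  have own : ∀ a : Fin I.n, t < d a → ∃ h : Fin I.m, o a = h + 1 ∧ I.Values a h := by
    intro a ha
    have h0 : o a ≠ 0 := fun h => by have := (L.zero_iff a a.2).2 h; omega
    obtain ⟨h, hh⟩ := Nat.exists_eq_succ_of_ne_zero h0
    have := L.edge a a.2 h hh
    exact ⟨⟨h, this.1⟩, hh, edge_iff.1 this.2⟩
  -- Tightness gives `t ≤ d b`, and the gap excludes equality.
  have ownY : ∀ (a : Fin I.n) (h : Fin I.m), t < d a → o a = h + 1 →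
      ∀ b, I.Values b h → t < d b := by
    intro a h ha hh b hb
    have h1 := L.tight a a.2 h hh b b.2 (edge_iff.2 hb)
    have h2 : d b ≠ t := fun h' => hgap ⟨b, b.2, ⟨h, h.2, edge_iff.2 hb⟩, h'⟩
    omega
  let X : Finset (Fin I.n) := Finset.univ.filter fun a => t < d a
  let Y : Finset (Fin I.m) :=
    Finset.univ.filter fun h => (∃ a, I.Values a h) ∧ ∀ a, I.Values a h → t < d a
  let M : Finset (Fin I.n × Fin I.m) :=
    Finset.univ.filter fun e => t < d e.1 ∧ o e.1 = e.2 + 1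
  have hfst : M.image Prod.fst = X := by
    ext a
    simp only [M, X, Finset.mem_image, Finset.mem_filter, Finset.mem_univ, true_and, Prod.exists,
      exists_and_right, exists_eq_right, exists_and_left, and_iff_left_iff_imp]
    exact fun ha => (own a ha).imp fun h hh => hh.1
  obtain ⟨a₀, ha₀, hd₀⟩ := hX
  obtain ⟨h₀, ho₀, hv₀⟩ := own ⟨a₀, ha₀⟩ hd₀
  refine ⟨hle, X, Y, M, ?_, ?_, ⟨⟨a₀, ha₀⟩, by simpa [X] using hd₀⟩, ⟨h₀, ?_⟩, ⟨?_, ?_, ?_⟩, ?_,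
    rfl, I.restrictAgent _ _, I.restrictHouse _ _, ?_, ?_, fun a h => rfl⟩
  · intro a ha
    simp only [X, Finset.mem_filter, Finset.mem_univ, true_and] at ha
    obtain ⟨h, -, hh⟩ := own a ha
    simpa using ⟨h, hh⟩
  · intro h hh
    simp only [Y, Finset.mem_filter, Finset.mem_univ, true_and] at hh
    simpa using hh.1
  · simp only [Y, Finset.mem_filter, Finset.mem_univ, true_and]
    exact ⟨⟨_, hv₀⟩, ownY _ _ hd₀ ho₀⟩
  · rintro ⟨a, h⟩ he
    simp only [M, X, Y, Finset.mem_filter, Finset.mem_univ, true_and] at he ⊢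
    have hv := edge_iff.1 (L.edge a a.2 h he.2).2
    exact ⟨hv, he.1, ⟨a, hv⟩, ownY a h he.1 he.2⟩
  · intro a ha
    simp only [X, M, Finset.mem_filter, Finset.mem_univ, true_and] at ha ⊢
    obtain ⟨h, hh, -⟩ := own a ha
    refine ⟨h, ⟨ha, hh⟩, fun h' hh' => Fin.ext ?_⟩
    omega
  · rw [← hfst, Finset.card_image_of_injOn, Finset.card_image_of_injOn]
    · rintro ⟨a, h⟩ h1 ⟨b, h'⟩ h2 (hab : a = b)
      simp only [M, Finset.coe_filter, Finset.mem_univ, true_and, Set.mem_ofPred_eq] at h1 h2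
      subst hab
      simp only [Prod.mk.injEq, true_and]
      exact Fin.ext (by omega)
    · rintro ⟨a, h⟩ h1 ⟨b, h'⟩ h2 (hab : h = h')
      simp only [M, Finset.coe_filter, Finset.mem_univ, true_and, Set.mem_ofPred_eq] at h1 h2
      subst hab
      simp only [Prod.mk.injEq, and_true]
      exact Fin.ext (L.inj a a.2 b b.2 (by omega) (by omega))
  · intro h hh a ha
    simp only [X, Y, Finset.mem_filter, Finset.mem_univ, true_and] at hh ⊢
    exact hh.2 a ha
  · intro a
    rw [mem_range_restrictAgent, hfst]
    simp [X]
  · intro h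
    rw [mem_range_restrictHouse, hq]
    simp only [M, Finset.mem_image, Finset.mem_filter, Finset.mem_univ, true_and, Prod.exists,
      exists_eq_right, not_iff_not]
    exact ⟨fun ⟨a, ha, h1, h2⟩ => ⟨⟨a, ha⟩, h1, h2⟩, fun ⟨a, h1, h2⟩ => ⟨a, a.2, h1, h2⟩⟩

/-- Ownership injects the remaining non-dummy houses into the remaining non-dummy agents and misses
an agent of label zero. Such an agent exists unless `t = 0`, where nothing but dummies remains. -/
theorem restrict_small (L : Labelling I.n I.m I.Edge d o I.m 0) (ht : t ≤ I.n)
    (hlow : ∀ i < t, ∃ a < I.n, (∃ h < I.m, I.Edge a h) ∧ d a = i)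
    (hgap : ¬ ∃ a < I.n, (∃ h < I.m, I.Edge a h) ∧ d a = t) (q : ℕ → Prop) [DecidablePred q]
    (hq : ∀ h, q h ↔ ¬ ∃ a < I.n, t < d a ∧ o a = h + 1) :
    (I.restrict (fun a => d a ≤ t) q).dummyHousesᶜ.card <
        (I.restrict (fun a => d a ≤ t) q).dummyAgentsᶜ.card ∨
      (I.restrict (fun a => d a ≤ t) q).dummyHousesᶜ = ∅ := by
  classical
  set J := I.restrict (fun a => d a ≤ t) q with hJ
  let α : Fin J.n ↪ Fin I.n := I.restrictAgent _ _
  let β : Fin J.m ↪ Fin I.m := I.restrictHouse _ _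
  have hα : ∀ a, a ∈ Set.range α ↔ d a ≤ t := I.mem_range_restrictAgent _ _
  have hβ : ∀ h, h ∈ Set.range β ↔ q h := I.mem_range_restrictHouse _ _
  have hv : ∀ a h, J.Values a h ↔ I.Values (α a) (β h) := fun a h => Iff.rfl
  have hdα : ∀ a, d (α a) ≤ t := fun a => (hα _).1 ⟨a, rfl⟩
  have hlt : ∀ a h, J.Values a h → d (α a) < t := by
    intro a h hah
    refine lt_of_le_of_ne (hdα a) fun h' => hgap ⟨α a, (α a).2, ⟨β h, (β h).2, ?_⟩, h'⟩
    exact edge_iff.2 hah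
  rcases Nat.eq_zero_or_pos t with rfl | hpos
  · right
    rw [Finset.eq_empty_iff_forall_notMem]
    intro h hh
    simp only [Finset.mem_compl, mem_dummyHouses, not_forall, not_not] at hh
    obtain ⟨a, ha⟩ := hh
    exact absurd (hlt a h ha) (by omega)
  · left
    obtain ⟨a, han, ⟨h, hhm, hE⟩, ha0⟩ := hlow 0 hpos
    -- An owner-held agent of `h` has label at most `0 + 1`, which does not exceed the positive `t`;
    -- so `h` survives and keeps `a` non-dummy.
    have hqh : q h := by
      rw [hq]
      rintro ⟨b, hb, h1, h2⟩
      have h3 := L.tight b hb h h2 a han hE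
      have : d a ≠ t := fun h' => hgap ⟨a, han, ⟨h, hhm, hE⟩, h'⟩
      omega
    obtain ⟨a', ha'⟩ := (hα ⟨a, han⟩).2 (by simp [ha0])
    obtain ⟨h', hh'⟩ := (hβ ⟨h, hhm⟩).2 hqh
    have ha'D : a' ∈ J.dummyAgentsᶜ := by
      simp only [Finset.mem_compl, mem_dummyAgents, not_forall, not_not]
      exact ⟨h', by rw [hv, ha', hh']; exact edge_iff.1 hE⟩
    have match_ : ∀ h : Fin J.m, ∃ a : Fin J.n, h ∈ J.dummyHousesᶜ →
        o (α a) = β h + 1 := by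
      intro h
      by_cases hh : h ∈ J.dummyHousesᶜ
      · have hh2 := hh
        simp only [Finset.mem_compl, mem_dummyHouses, not_forall, not_not] at hh
        obtain ⟨b, hb⟩ := hh
        rcases L.done (β h) (β h).2 (by omega) with ⟨c, hc, hco⟩ | hst
        · have hcd : d c ≤ t := by
            by_contra hcon
            exact (hq _).1 ((hβ _).1 ⟨h, rfl⟩) ⟨c, hc, by omega, hco⟩
          obtain ⟨c', hc'⟩ := (hα ⟨c, hc⟩).2 hcd
          exact ⟨c', fun _ => by rw [hc']; exact hco⟩
        -- A house that gave up has valuers only at label `n + 1`, but the surviving valuer `b` has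
        -- label at most `t ≤ n`.
        · have := hst (α b) (α b).2 (edge_iff.2 hb)
          have := hdα b
          omega
      -- An arbitrary value for dummy houses.
      · exact ⟨a', fun h => absurd h hh⟩
    choose f hf using match_
    refine lt_of_le_of_lt ?_ (Finset.card_erase_lt_of_mem ha'D)
    refine Finset.card_le_card_of_injOn f (fun h hh => ?_) fun h1 hh1 h2 hh2 h12 => ?_
    · have ho := hf h hh
      simp only [Finset.coe_erase, Set.mem_sdiff, Finset.mem_coe, Finset.mem_compl,
        mem_dummyAgents, not_forall, not_not, Set.mem_singleton_iff]
      refine ⟨⟨h, ?_⟩, fun hfa => ?_⟩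
      · exact (hv _ _).2 (edge_iff.1 (L.edge _ (α (f h)).2 (β h) ho).2)
      · rw [hfa, ha'] at ho
        have := (L.zero_iff a han).1 ha0
        simp only at ho
        omega
    · have ho1 := hf h1 hh1
      have ho2 := hf h2 hh2
      rw [h12] at ho1
      exact β.injective (Fin.ext (by omega))

/-- Eliminating the agents with labels above the threshold and their houses is an exhaustive
application of the second rule. -/
theorem restrict_spec (L : Labelling I.n I.m I.Edge d o I.m 0) (ht : IsThreshold I d t)
    (q : ℕ → Prop) [DecidablePred q]
    (hq : ∀ h, q h ↔ ¬ ∃ a < I.n, t < d a ∧ o a = h + 1) :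
    (I.restrict (fun a => d a ≤ t) q = I ∨ I.Rule2 (I.restrict (fun a => d a ≤ t) q)) ∧
    ((I.restrict (fun a => d a ≤ t) q).dummyHousesᶜ.card <
        (I.restrict (fun a => d a ≤ t) q).dummyAgentsᶜ.card ∨
      (I.restrict (fun a => d a ≤ t) q).dummyHousesᶜ = ∅) := by
  have heq : (¬ ∃ a < I.n, t < d a) → I.restrict (fun a => d a ≤ t) q = I := by
    intro h
    push Not at h
    refine restrict_eq_self _ _ h fun h' _ => (hq h').2 ?_
    rintro ⟨a, ha, h1, -⟩
    exact absurd (h a ha) (by omega)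
  rcases ht with ⟨hlt, rfl⟩ | ⟨hle, htn, hlow, hgap⟩
  · have := heq (by rintro ⟨a, ha, h⟩; have := L.le a ha; omega)
    rw [this]
    exact ⟨.inl rfl, .inl hlt⟩
  · refine ⟨?_, L.restrict_small htn hlow hgap q hq⟩
    by_cases hX : ∃ a < I.n, t < d a
    · exact .inr (L.rule2 hle hgap q hq hX)
    · exact .inl (heq hX)

/-- If the smallest free label is above `i`, then `i` is at most the number of agents. -/
theorem label_le {n i : ℕ} {P : ℕ → Prop} (h : ∀ l < i, ∃ a < n, P a ∧ d a = l) : i ≤ n := by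
  choose! f hf using h
  have : (Finset.range i).card ≤ (Finset.range n).card := by
    refine Finset.card_le_card_of_injOn f (fun l hl => ?_) fun l hl l' hl' hll => ?_
    · simp only [Finset.coe_range, Set.mem_Iio] at hl ⊢
      exact (hf l hl).1
    · simp only [Finset.coe_range, Set.mem_Iio] at hl hl'
      rw [← (hf l hl).2.2, ← (hf l' hl').2.2, hll]
  simpa using this

theorem exists_isThreshold (I : Instance) (d : ℕ → ℕ) : ∃ t, IsThreshold I d t := by
  classical
  by_cases h : I.dummyAgentsᶜ.card ≤ I.dummyHousesᶜ.card
  · have hex : ∃ t, ¬ ∃ a < I.n, (∃ h < I.m, I.Edge a h) ∧ d a = t := by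
      by_contra! hcon
      have := label_le (n := I.n) (i := I.n + 1) (d := d) (P := fun a => ∃ h < I.m, I.Edge a h)
        fun l _ => hcon l
      omega
    refine ⟨Nat.find hex, .inr ⟨h, ?_, ?_, Nat.find_spec hex⟩⟩
    · exact label_le (d := d) (P := fun a => ∃ h < I.m, I.Edge a h)
        fun l hl => not_not.1 (Nat.find_min hex hl)
    · exact fun l hl => not_not.1 (Nat.find_min hex hl)
  · exact ⟨_, .inl ⟨by omega, rfl⟩⟩

end Labelling

/-! ### Traversing the matrix, and the memory layout -/

open Instance

namespace Frame

variable {p q r : Prog} {s s' s'' : State}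

theorem trans (h : Frame p s s') (h' : Frame q s' s'') (hv : p.vars ⊆ r.vars)
    (ha : p.arrs ⊆ r.arrs) (hv' : q.vars ⊆ r.vars) (ha' : q.arrs ⊆ r.arrs) : Frame r s s'' :=
  ⟨fun x hx => (h'.var x fun h => hx (hv' h)).trans (h.var x fun h => hx (hv h)),
    fun x hx => (h'.arr x fun h => hx (ha' h)).trans (h.arr x fun h => hx (ha h))⟩

theorem setVar {x v : ℕ} (h : Frame p (s.setVar x v) s') (hx : x ∈ r.vars) (hv : p.vars ⊆ r.vars)
    (ha : p.arrs ⊆ r.arrs) : Frame r s s' := by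
  refine ⟨fun y hy => ?_, fun y hy => h.arr y fun h => hy (ha h)⟩
  rw [h.var y fun h => hy (hv h), State.setVar_var, if_neg]
  rintro rfl
  exact hy hx

end Frame

/-- Run `p` for all agents (variable `3`) and houses (variable `4`), with the position in the
matrix in the variable `5`. -/
def Prog.matrix (p : Prog) : Prog :=
  .seq (.assign 5 (.const 0))
    (.upTo 3 0 (.upTo 4 1 (.seq p (.assign 5 (.add (.var 5) (.const 1))))))

/-- The invariant is indexed by the position in row-major order, and `wrap` identifies the end of a
row with the start of the next. It must ignore the counters, hence `hInv`. -/
theorem Runs.matrix {N n m : ℕ} {p : Prog} {s : State} {Q : State → Prop}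
    (Inv : ℕ → ℕ → State → Prop) (hn : s.var 0 = n) (hm : s.var 1 = m) (hnN : n ≤ N) (hmN : m ≤ N)
    (hp : ∀ x ∈ [0, 1, 3, 4, 5], x ∉ p.vars)
    (hInv : ∀ i j s x v, x ∈ [3, 4, 5] → Inv i j s → Inv i j (s.setVar x v))
    (h0 : Inv 0 0 s)
    (step : ∀ i < n, ∀ j < m, ∀ s', Frame (.matrix p) s s' → s'.var 3 = i → s'.var 4 = j →
      s'.var 5 = i * m + j → Inv i j s' → Runs N p s' (Inv i (j + 1)))
    (wrap : ∀ i s', Inv i m s' → Inv (i + 1) 0 s')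
    (post : ∀ s', Frame (.matrix p) s s' → Inv n 0 s' → Q s') :
    Runs N (.matrix p) s Q := by
  have hp0 : 0 ∉ p.vars := hp 0 (by simp)
  have hp1 : 1 ∉ p.vars := hp 1 (by simp)
  have hp3 : 3 ∉ p.vars := hp 3 (by simp)
  have hp4 : 4 ∉ p.vars := hp 4 (by simp)
  have hp5 : 5 ∉ p.vars := hp 5 (by simp)
  refine .seq (.assign (.upTo (fun i s' => Inv i 0 s' ∧ s'.var 5 = i * m) ?_ ?_ ?_ ?_ ?_ ?_ ?_))
  · simpa [Exp.eval, hn] using hnN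
  · simp [Prog.vars, Prog.upTo, hp3]
  · simp [Prog.vars, Prog.upTo, hp0]
  · simp
  · refine ⟨hInv _ _ _ _ _ (by simp) (hInv _ _ _ _ _ (by simp) h0), ?_⟩
    simp [Exp.eval]
  · intro i hi s₁ hf₁ h3 ⟨hI, h5⟩
    have hi : i < n := by simpa [hn] using hi
    have hm₁ : s₁.var 1 = m := by
      rw [hf₁.var 1 (by simp [Prog.vars, Prog.upTo, hp1])]; simp [hm]
    refine .upTo (fun j s' => Inv i j s' ∧ s'.var 5 = i * m + j) ?_ ?_ ?_ ?_ ?_ ?_ ?_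
    · simpa [hm₁] using hmN
    · simp [Prog.vars, hp4]
    · simp [Prog.vars, hp1]
    · simp
    · exact ⟨hInv _ _ _ _ _ (by simp) hI, by simpa using h5⟩
    · intro j hj s₂ hf₂ h4 ⟨hJ, h5'⟩
      have hj : j < m := by simpa [hm₁] using hj
      refine .seq ((step i hi j hj s₂ ?_ ?_ h4 h5' hJ).mono fun s₃ hf₃ h => .assign ?_)
      · refine (hf₁.trans (r := .seq (.assign 5 (.const 0)) (.upTo 3 0 (.upTo 4 1 (.seq p
          (.assign 5 (.add (.var 5) (.const 1))))))) hf₂ ?_ ?_ ?_ ?_).setVar (x := 5) (v := 0)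
            ?_ ?_ ?_ <;> simp only [Prog.vars, Prog.arrs, Prog.upTo, Prog.matrix] <;> grind
      · rw [hf₂.var 3 (by simp [Prog.vars, Prog.upTo, hp3]), h3]
      · refine ⟨hInv _ _ _ _ _ (by simp) (hInv _ _ _ _ _ (by simp) h), ?_⟩
        simp [Exp.eval, hf₃.var 5 hp5, h5']
        ring
    · intro s₂ hf₂ ⟨hJ, h5'⟩
      rw [hm₁] at hJ h5'
      refine ⟨hInv _ _ _ _ _ (by simp) (wrap _ _ hJ), ?_⟩
      simp [h5']
      ring
  · intro s₁ hf₁ ⟨hI, _⟩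
    refine post s₁ ?_ ?_
    · exact hf₁.setVar (r := .matrix p) (by simp [Prog.vars, Prog.matrix])
        (by simp [Prog.vars, Prog.matrix]) (by simp [Prog.arrs, Prog.matrix])
    · simpa [Exp.eval, hn] using hI

/-- The state holds the instance `I`, and possibly more. -/
structure Holds (I : Instance) (s : State) : Prop where
  n : s.var 0 = I.n
  m : s.var 1 = I.m
  k : s.var 2 = I.k
  u : s.arr 0 = I.input.arr 0

theorem Holds.of_frame {I : Instance} {p : Prog} {s s' : State} (h : Holds I s) (hf : Frame p s s')
    (hp : 0 ∉ p.vars ∧ 1 ∉ p.vars ∧ 2 ∉ p.vars ∧ 0 ∉ p.arrs) : Holds I s' :=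
  ⟨(hf.var 0 hp.1).trans h.n, (hf.var 1 hp.2.1).trans h.m, (hf.var 2 hp.2.2.1).trans h.k,
    (hf.arr 0 hp.2.2.2).trans h.u⟩

theorem Holds.setVar {I : Instance} {s : State} (h : Holds I s) {x v : ℕ} (hx : 3 ≤ x) :
    Holds I (s.setVar x v) := by
  refine ⟨?_, ?_, ?_, h.u⟩ <;> rw [State.setVar_var, if_neg (by omega)]
  exacts [h.n, h.m, h.k]

theorem holds_input (I : Instance) : Holds I I.input := by
  constructor <;> simp [Instance.input]

theorem input_apply (I : Instance) (a : Fin I.n) (h : Fin I.m) :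
    I.input.arr 0 (a * I.m + h) = I.u a h := by
  have h1 : ((a : ℕ) * I.m + h) / I.m = a := by
    rw [mul_comm, Nat.mul_add_div (by have := h.2; omega), Nat.div_eq_of_lt h.2, add_zero]
  have h2 : ((a : ℕ) * I.m + h) % I.m = h := by
    rw [mul_comm, Nat.mul_add_mod, Nat.mod_eq_of_lt h.2]
  simp [Instance.input, h1, h2]

theorem input_ne_zero_iff (I : Instance) {a h : ℕ} (ha : a < I.n) (hh : h < I.m) :
    I.input.arr 0 (a * I.m + h) ≠ 0 ↔ I.Edge a h := by
  have h1 := input_apply I ⟨a, ha⟩ ⟨h, hh⟩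
  simp only at h1
  rw [h1]
  simp only [Edge, ha, hh, exists_true_left, Values]
  omega

/-! ### The auction -/

namespace Prog

/-- Find the smallest label among the agents that value the house `c`, where the variable `6`
holds `c + 1`. The label (at most one more than the number of agents) goes to the variable `8`,
and an agent that has it to the variable `7`. -/
def scan : Prog :=
  .seq (.assign 8 (.add (.var 0) (.const 1))) <|
  .seq (.assign 5 (.const 0)) <|
  .upTo 3 0 <| .seq
    (.ite (.get 0 (.sub (.add (.var 5) (.var 6)) (.const 1)))
      (.ite (.sub (.var 8) (.get 1 (.var 3)))
        (.seq (.assign 7 (.var 3)) (.assign 8 (.get 1 (.var 3)))) .skip) .skip)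
    (.assign 5 (.add (.var 5) (.var 1)))

/-- One bid of the house that is in the variable `6`. -/
def bid : Prog :=
  .seq scan <|
  .ite (.sub (.add (.var 0) (.const 1)) (.var 8))
    (.seq (.assign 9 (.get 2 (.var 7))) <|
     .seq (.put 2 (.var 7) (.var 6)) <|
     .seq (.put 1 (.var 7) (.add (.var 8) (.const 1))) <|
     .assign 6 (.var 9))
    (.assign 6 (.const 0))

/-- The auction. -/
def auction : Prog :=
  .upTo 10 1 (.seq (.assign 6 (.add (.var 10) (.const 1))) (.loop (.var 6) bid))

end Prog

/-- The starting value `n + 1` of variable `8` doubles as the signal that no valuer has a label of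
at most `n`. -/
theorem runs_scan {I : Instance} {N c : ℕ} {s : State} (hs : Holds I s) (hN : I.n ≤ N)
    (h6 : s.var 6 = c) (hc : c ≠ 0) (hcm : c ≤ I.m) :
    Runs N .scan s fun s' => (∀ b < I.n, I.Edge b (c - 1) → s'.var 8 ≤ s.arr 1 b) ∧
      (s'.var 8 = I.n + 1 ∨ s'.var 7 < I.n ∧ I.Edge (s'.var 7) (c - 1) ∧
        s.arr 1 (s'.var 7) = s'.var 8) := by
  refine .seq (.assign (.seq (.assign (.upTo (fun i s' => s'.var 5 = i * I.m ∧
    (∀ b < i, I.Edge b (c - 1) → s'.var 8 ≤ s.arr 1 b) ∧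
      (s'.var 8 = I.n + 1 ∨ s'.var 7 < I.n ∧ I.Edge (s'.var 7) (c - 1) ∧
        s.arr 1 (s'.var 7) = s'.var 8)) ?_ (by decide) (by decide) (by decide) ?_ ?_ ?_))))
  · simpa [hs.n] using hN
  · simp [Exp.eval, hs.n]
  · intro i hi s' hf h3 ⟨h5, hmin, hat⟩
    have hi : i < I.n := by simpa [hs.n] using hi
    have e0 : s'.arr 0 = I.input.arr 0 := by rw [hf.arr 0 (by decide)]; simp [hs.u]
    have e1 : s'.arr 1 = s.arr 1 := by rw [hf.arr 1 (by decide)]; simp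
    have e6 : s'.var 6 = c := by rw [hf.var 6 (by decide)]; simp [h6]
    have ev1 : s'.var 1 = I.m := by rw [hf.var 1 (by decide)]; simp [hs.m]
    have hpos : i * I.m + c - 1 = i * I.m + (c - 1) := by omega
    have hE := input_ne_zero_iff I hi (show c - 1 < I.m by omega)
    have hsucc : (i + 1) * I.m = i * I.m + I.m := by ring
    refine .seq (.ite (fun h => ?_) fun h => .skip (.assign ?_))
    · simp only [Exp.eval, e0, h5, e6, hpos] at h
      have hEi := hE.1 h
      refine .ite (fun h' => ?_) fun h' => .skip (.assign ?_)
      · simp only [Exp.eval, e1, h3] at h'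
        refine .seq (.assign (.assign (.assign ?_)))
        simp only [Exp.eval, State.setVar_var, e1, h3, State.setVar_arr, h5, ev1, hsucc]
        simp only [Nat.reduceEqDiff, if_true, if_false, true_and]
        refine ⟨fun b hb hEb => ?_, .inr ⟨hi, hEi, by simp⟩⟩
        rcases Nat.lt_succ_iff_lt_or_eq.1 hb with hb | rfl
        · have := hmin b hb hEb
          simp; omega
        · simp
      · simp only [Exp.eval, e1, h3] at h'
        simp only [Exp.eval, State.setVar_var, h5, ev1, hsucc]
        simp only [Nat.reduceEqDiff, if_true, if_false, true_and]
        refine ⟨fun b hb hEb => ?_, by simpa using hat⟩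
        rcases Nat.lt_succ_iff_lt_or_eq.1 hb with hb | rfl
        · simpa using hmin b hb hEb
        · omega
    · simp only [Exp.eval, e0, h5, e6, hpos] at h
      simp only [Exp.eval, State.setVar_var, h5, ev1, hsucc]
      simp only [Nat.reduceEqDiff, if_true, if_false, true_and]
      refine ⟨fun b hb hEb => ?_, by simpa using hat⟩
      rcases Nat.lt_succ_iff_lt_or_eq.1 hb with hb | rfl
      · simpa using hmin b hb hEb
      · exact absurd h (hE.2 hEb)
  · intro s' hf ⟨_, h1, h2⟩
    refine ⟨fun b hb => h1 b ?_, h2⟩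
    simpa [hs.n] using hb

theorem runs_bid {I : Instance} {N p : ℕ} {s : State} (hs : Holds I s) (hN : I.n ≤ N)
    (hp : p ≤ I.m) (hc : s.var 6 ≠ 0)
    (L : Labelling I.n I.m I.Edge (s.arr 1) (s.arr 2) p (s.var 6)) :
    Runs N .bid s fun s' => Labelling I.n I.m I.Edge (s'.arr 1) (s'.arr 2) p (s'.var 6) ∧
      (s'.var 6 = 0 ∧ s'.arr 1 = s.arr 1 ∨
        ∃ a < I.n, s'.arr 1 = Function.update (s.arr 1) a (s.arr 1 a + 1)) := by
  have hcm := L.cur_le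
  refine .seq ((runs_scan hs hN rfl hc (by omega)).mono fun s₁ hf ⟨hmin, hat⟩ => ?_)
  have hs₁ := hs.of_frame hf (by decide)
  have e1 : s₁.arr 1 = s.arr 1 := hf.arr 1 (by decide)
  have e2 : s₁.arr 2 = s.arr 2 := hf.arr 2 (by decide)
  have e6 : s₁.var 6 = s.var 6 := hf.var 6 (by decide)
  refine .ite (fun h => ?_) fun h => .assign ?_
  · simp only [Exp.eval, hs₁.n] at h
    obtain ⟨ha, hE, hd⟩ := hat.resolve_left (by omega)
    refine .seq (.assign (.seq (.put (.seq (.put (.assign ?_))))))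
    have := L.bid hc (by omega) ha hE (by omega) (fun b hb hEb => by rw [hd]; exact hmin b hb hEb)
    rw [hd] at this
    simp only [Exp.eval, State.setVar_var, State.setVar_arr, State.setArr_arr, State.setArr_var,
      e1, e2, e6]
    simp only [Nat.reduceEqDiff, if_true, if_false]
    refine ⟨by simpa using this, .inr ⟨_, ha, ?_⟩⟩
    simp [hd]
  · simp only [Exp.eval, hs₁.n] at h
    refine ⟨?_, .inl ⟨by simp [Exp.eval], by simp [e1]⟩⟩
    have := L.giveUp fun b hb hEb => by have := hmin b hb hEb; omega
    simpa [e1, e2, Exp.eval] using this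

/-- The variant of the inner loop is the total amount by which labels can still rise, plus one while
a house is bidding; the extra unit pays for giving up, which raises no label. -/
theorem runs_auction {I : Instance} {N : ℕ} {s : State} (hs : Holds I s) (hn : I.n ≤ N)
    (hm : I.m ≤ N) (hN : I.n * (I.n + 1) + 1 ≤ N) (h1 : s.arr 1 = fun _ => 0)
    (h2 : s.arr 2 = fun _ => 0) :
    Runs N .auction s fun s' => Labelling I.n I.m I.Edge (s'.arr 1) (s'.arr 2) I.m 0 := by
  refine .upTo (fun i s' => Labelling I.n I.m I.Edge (s'.arr 1) (s'.arr 2) i 0)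
    (by rwa [hs.m]) (by decide) (by decide) (by decide) ?_ ?_ ?_
  · simpa [h1, h2] using Labelling.init I.n I.m I.Edge
  · intro i hi s₁ hf h10 L
    rw [hs.m] at hi
    have hs₁ := hs.of_frame hf (by decide)
    refine .seq (.assign ?_)
    refine .loop (fun s' => Labelling I.n I.m I.Edge (s'.arr 1) (s'.arr 2) (i + 1) (s'.var 6))
      (fun s' => (I.n * (I.n + 1) - ∑ a ∈ Finset.range I.n, s'.arr 1 a) +
        if s'.var 6 = 0 then 0 else 1) ?_ ?_ ?_ ?_
    · simpa [Exp.eval, h10] using L.next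
    · refine le_trans ?_ hN
      split_ifs <;> omega
    · intro s₂ hf₂ L₂ hc
      have hs₂ : Holds I s₂ := (hs₁.setVar (by decide)).of_frame hf₂ (by decide)
      refine (runs_bid hs₂ hn (by omega) hc L₂).mono fun s₃ _ ⟨L₃, h⟩ => ⟨L₃, ?_⟩
      rw [if_neg (show s₂.var 6 ≠ 0 from hc)]
      rcases h with ⟨h6, hd⟩ | ⟨a, ha, hd⟩
      · rw [hd, if_pos h6]; omega
      · have hle : ∑ a ∈ Finset.range I.n, s₃.arr 1 a ≤ I.n * (I.n + 1) := by
          have := Finset.sum_le_card_nsmul (Finset.range I.n) (s₃.arr 1) (I.n + 1)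
            fun a ha => L₃.le a (Finset.mem_range.1 ha)
          simpa using this
        have hsum : ∑ a ∈ Finset.range I.n, s₃.arr 1 a =
            ∑ a ∈ Finset.range I.n, s₂.arr 1 a + 1 := by
          rw [hd, Finset.sum_update_of_mem (Finset.mem_range.2 ha),
            ← Finset.add_sum_erase _ _ (Finset.mem_range.2 ha), Finset.sdiff_singleton_eq_erase]
          omega
        split_ifs <;> omega
    · intro s₂ _ L₂ hc
      have hc : s₂.var 6 = 0 := hc
      simpa [hc] using L₂
  · intro s' _ L
    rwa [hs.m] at L

theorem card_eq_count {n : ℕ} (S : Finset (Fin n)) (P : ℕ → Prop) [DecidablePred P]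
    (h : ∀ i, i ∈ S ↔ P i) : S.card = Nat.count P n := by
  rw [Nat.count_eq_card_filter_range, ← Finset.card_map Fin.valEmbedding]
  congr 1
  ext i
  simp only [Finset.mem_map, h, Fin.valEmbedding_apply, Finset.mem_filter, Finset.mem_range]
  exact ⟨fun ⟨a, ha, hi⟩ => hi ▸ ⟨a.2, ha⟩, fun ⟨h1, h2⟩ => ⟨⟨i, h1⟩, h2, rfl⟩⟩

/-- This allows testing `Rule1` for the restriction on the original matrix, before anything is
overwritten. -/
theorem card_dummyHouses_restrict (I : Instance) (p q : ℕ → Prop) [DecidablePred p]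
    [DecidablePred q] (P : ℕ → Prop) [DecidablePred P]
    (hP : ∀ h, P h ↔ q h ∧ ¬ ∃ a, p a ∧ I.Edge a h) :
    (I.restrict p q).dummyHouses.card = Nat.count P I.m := by
  rw [← Finset.card_map (I.restrictHouse p q)]
  refine card_eq_count _ _ fun h => ?_
  rw [Finset.mem_map, hP, ← I.mem_range_restrictHouse p q]
  constructor
  · rintro ⟨h, hh, rfl⟩
    refine ⟨⟨h, rfl⟩, ?_⟩
    rintro ⟨a, hpa, han, hhm, hv⟩
    obtain ⟨a', ha'⟩ := (I.mem_range_restrictAgent p q ⟨a, han⟩).2 hpa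
    rw [mem_dummyHouses] at hh
    refine hh a' ?_
    rw [restrict_values, ha']
    exact hv
  · rintro ⟨⟨h, rfl⟩, hh⟩
    refine ⟨h, mem_dummyHouses.2 fun a ha => hh ⟨I.restrictAgent p q a, ?_, edge_iff.2 ha⟩, rfl⟩
    exact (I.mem_range_restrictAgent p q _).1 ⟨a, rfl⟩

/-! ### The threshold -/

namespace Prog

/-- Mark in the array `R` the agents whose label is at most the variable `13` and that value a
house, and in the array `C` the houses that such agents value. -/
def marks (R C : ℕ) : Prog :=
  .matrix <| .ite (.get 0 (.var 5))
    (.ite (.sub (.get 1 (.var 3)) (.var 13)) .skip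
      (.seq (.put R (.var 3) (.const 1)) (.put C (.var 4) (.const 1)))) .skip

/-- Mark in the array `X` the values of `f` at the agents for which `e` is nonzero. -/
def image (X : ℕ) (e f : Exp) : Prog :=
  .upTo 3 0 (.ite e (.put X f (.const 1)) .skip)

/-- Compute a threshold for the labels in the variable `13`. -/
def threshold : Prog :=
  .seq (.assign 13 (.add (.var 0) (.const 1))) <|
  .seq (.marks 3 4) <|
  .seq (.count 11 0 (.get 3 (.var 3))) <|
  .seq (.count 12 1 (.get 4 (.var 3))) <|
  .seq (.image 5 (.get 3 (.var 3)) (.get 1 (.var 3))) <|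
  .ite (.sub (.add (.var 12) (.const 1)) (.var 11))
    (.seq (.assign 13 (.const 0))
      (.loop (.get 5 (.var 13)) (.assign 13 (.add (.var 13) (.const 1))))) .skip

end Prog

theorem runs_marks {I : Instance} {N R C : ℕ} {s : State} (hs : Holds I s) (hn : I.n ≤ N)
    (hm : I.m ≤ N) (hRC : R ≠ C) (hR : R ∉ [0, 1]) (hC : C ∉ [0, 1]) (h1 : s.arr R = fun _ => 0)
    (h2 : s.arr C = fun _ => 0) :
    Runs N (.marks R C) s fun s' =>
      (∀ a, s'.arr R a ≠ 0 ↔ ∃ h, s.arr 1 a ≤ s.var 13 ∧ I.Edge a h) ∧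
      ∀ h, s'.arr C h ≠ 0 ↔ ∃ a, s.arr 1 a ≤ s.var 13 ∧ I.Edge a h := by
  simp only [List.mem_cons, List.not_mem_nil, or_false, not_or] at hR hC
  -- The edges within the label bound that precede position `(i, j)`.
  let W : ℕ → ℕ → ℕ → ℕ → Prop := fun i j a h =>
    (a < i ∨ a = i ∧ h < j) ∧ s.arr 1 a ≤ s.var 13 ∧ I.Edge a h
  have hW : ∀ i j a h, W i (j + 1) a h ↔ W i j a h ∨ a = i ∧ h = j ∧ s.arr 1 i ≤ s.var 13 ∧
      I.Edge i j := by
    intro i j a h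
    simp only [W]
    constructor
    · rintro ⟨h1 | ⟨rfl, h1⟩, h2⟩
      · exact .inl ⟨.inl h1, h2⟩
      · rcases Nat.lt_succ_iff_lt_or_eq.1 h1 with h1 | rfl
        · exact .inl ⟨.inr ⟨rfl, h1⟩, h2⟩
        · exact .inr ⟨rfl, rfl, h2⟩
    · rintro (⟨h1, h2⟩ | ⟨rfl, rfl, h2⟩)
      · exact ⟨by omega, h2⟩
      · exact ⟨by omega, h2⟩
  have hWm : ∀ i a h, W i I.m a h ↔ W (i + 1) 0 a h := by
    intro i a h
    simp only [W]
    refine and_congr_left fun ⟨_, _, h, _⟩ => by omega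
  have hWn : ∀ a h, W I.n 0 a h ↔ s.arr 1 a ≤ s.var 13 ∧ I.Edge a h := by
    intro a h
    simp only [W, and_iff_right_iff_imp]
    exact fun ⟨_, h, _⟩ => .inl h
  refine .matrix (fun i j s' => (∀ a, s'.arr R a ≠ 0 ↔ ∃ h, W i j a h) ∧
    ∀ h, s'.arr C h ≠ 0 ↔ ∃ a, W i j a h) hs.n hs.m hn hm (by simp [Prog.vars])
    (fun i j s x v _ h => h) (by simp [h1, h2, W]) ?_ ?_ ?_
  · intro i hi j hj s' hf h3 h4 h5 ⟨hr, hc⟩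
    have e0 : s'.arr 0 = I.input.arr 0 := by
      rw [hf.arr 0 (by simp [Prog.arrs, Prog.matrix, Prog.upTo]; omega), hs.u]
    have e1 : s'.arr 1 = s.arr 1 := by
      rw [hf.arr 1 (by simp [Prog.arrs, Prog.matrix, Prog.upTo]; omega)]
    have e13 : s'.var 13 = s.var 13 := hf.var 13 (by
      simp [Prog.vars, Prog.matrix, Prog.upTo])
    have hE := input_ne_zero_iff I hi hj
    have idle : ¬ (s.arr 1 i ≤ s.var 13 ∧ I.Edge i j) →
        (∀ a, s'.arr R a ≠ 0 ↔ ∃ h, W i (j + 1) a h) ∧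
          ∀ h, s'.arr C h ≠ 0 ↔ ∃ a, W i (j + 1) a h := by
      intro hno
      simp only [hW, hno, and_false, or_false]
      exact ⟨hr, hc⟩
    refine .ite (fun h => .ite (fun h' => .skip (idle ?_)) fun h' => .seq (.put (.put ?_)))
      fun h => .skip (idle ?_)
    · simp only [Exp.eval, e1, e13, h3] at h'
      omega
    · simp only [Exp.eval, e0, h5] at h
      simp only [Exp.eval, e1, e13, h3] at h'
      have hyes : s.arr 1 i ≤ s.var 13 ∧ I.Edge i j := ⟨by omega, hE.1 h⟩
      simp only [hW, hyes, and_true, Exp.eval, State.setArr_arr, State.setArr_var, h3, h4,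
        hRC, hRC.symm, if_true, if_false]
      constructor
      · intro a
        by_cases ha : a = i
        · subst ha; simp
        · simpa [ha] using hr a
      · intro a
        by_cases ha : a = j
        · subst ha; simp
        · simpa [ha] using hc a
    · simp only [Exp.eval, e0, h5] at h
      exact fun hyes => hE.2 hyes.2 h
  · intro i s' h
    simpa only [hWm] using h
  · intro s' _ h
    simpa only [hWn] using h

theorem runs_image {I : Instance} {N X : ℕ} {e f : Exp} {s : State} (hs : Holds I s) (hn : I.n ≤ N)
    (h0 : s.arr X = fun _ => 0) (P : ℕ → Prop) (g : ℕ → ℕ)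
    (he : ∀ s', Frame (.image X e f) s s' → (e.eval s' ≠ 0 ↔ P (s'.var 3)))
    (hf : ∀ s', Frame (.image X e f) s s' → f.eval s' = g (s'.var 3)) :
    Runs N (.image X e f) s fun s' => ∀ l, s'.arr X l ≠ 0 ↔ ∃ a < I.n, P a ∧ g a = l := by
  refine .upTo (fun i s' => ∀ l, s'.arr X l ≠ 0 ↔ ∃ a < i, P a ∧ g a = l) (by rwa [hs.n])
    (by simp [Prog.vars]) (by simp [Prog.vars]) (by simp) (by simp [h0]) ?_ ?_
  · intro i hi s' hfr h3 hI
    have e1 := he s' hfr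
    have e2 := hf s' hfr
    rw [h3] at e1 e2
    refine .ite (fun h => .put fun l => ?_) fun h => .skip fun l => ?_
    · simp only [State.setVar_arr, State.setArr_arr, if_true, e2, Exp.eval]
      by_cases hl : l = g i
      · subst hl
        simpa using ⟨i, by omega, e1.1 h, rfl⟩
      · rw [Function.update_of_ne hl, hI]
        constructor
        · rintro ⟨a, ha, h'⟩
          exact ⟨a, by omega, h'⟩
        · rintro ⟨a, ha, h', h''⟩
          refine ⟨a, lt_of_le_of_ne (by omega) ?_, h', h''⟩
          rintro rfl
          exact hl h''.symm
    · simp only [State.setVar_arr]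
      rw [hI]
      constructor
      · rintro ⟨a, ha, h'⟩
        exact ⟨a, by omega, h'⟩
      · rintro ⟨a, ha, h', h''⟩
        refine ⟨a, lt_of_le_of_ne (by omega) ?_, h', h''⟩
        rintro rfl
        exact e1.2 h' h
  · intro s' _ h
    rwa [hs.n] at h

theorem runs_threshold {I : Instance} {N : ℕ} {s : State} (hs : Holds I s) (hn : I.n ≤ N)
    (hm : I.m ≤ N) (hd : ∀ a < I.n, s.arr 1 a ≤ I.n + 1) (h3 : s.arr 3 = fun _ => 0)
    (h4 : s.arr 4 = fun _ => 0) (h5 : s.arr 5 = fun _ => 0) :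
    Runs N .threshold s fun s' => IsThreshold I (s.arr 1) (s'.var 13) := by
  classical
  refine .seq (.assign ?_)
  set s₀ := s.setVar 13 ((Exp.add (.var 0) (.const 1)).eval s) with hs₀
  -- At this value no label fails the test in `marks`, so exactly the non-dummy agents and houses
  -- get marked. It is also the right threshold if the counting condition fails.
  have v13 : s₀.var 13 = I.n + 1 := by simp [hs₀, Exp.eval, hs.n]
  have H₀ : Holds I s₀ := hs.setVar (by decide)
  have a1 : s₀.arr 1 = s.arr 1 := rfl
  refine .seq ((runs_marks H₀ hn hm (by decide) (by decide) (by decide) h3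
    h4).mono fun s₁ f₁ ⟨hr, hc⟩ => ?_)
  have H₁ := H₀.of_frame f₁ (by decide)
  have hr' : ∀ a, a < I.n → (s₁.arr 3 a ≠ 0 ↔ ∃ h < I.m, I.Edge a h) := by
    intro a ha
    rw [hr, v13, a1]
    exact ⟨fun ⟨h, _, h2⟩ => ⟨h, h2.2.1, h2⟩, fun ⟨h, _, h2⟩ => ⟨h, hd a ha, h2⟩⟩
  have hc' : ∀ h, s₁.arr 4 h ≠ 0 ↔ ∃ a, I.Edge a h := by
    intro h
    rw [hc, v13, a1]
    exact ⟨fun ⟨a, _, h2⟩ => ⟨a, h2⟩, fun ⟨a, h2⟩ => ⟨a, hd a h2.1, h2⟩⟩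
  refine .seq (.count (fun a => ∃ h < I.m, I.Edge a h) (by rwa [H₁.n]) (by decide) (by decide)
    (by decide) (fun i hi s' hf h3 => ?_) fun s₂ f₂ e11 => ?_)
  · rw [H₁.n] at hi
    simp only [Exp.eval, h3, hf.arr 3 (by decide)]
    exact hr' i hi
  have H₂ := H₁.of_frame f₂ (by decide)
  refine .seq (.count (fun h => ∃ a, I.Edge a h) (by rwa [H₂.m]) (by decide) (by decide)
    (by decide) (fun i hi s' hf h3 => ?_) fun s₃ f₃ e12 => ?_)
  · simp only [Exp.eval, h3, hf.arr 4 (by decide), f₂.arr 4 (by decide)]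
    exact hc' i
  have H₃ := H₂.of_frame f₃ (by decide)
  have hA : I.dummyAgentsᶜ.card = s₃.var 11 := by
    rw [f₃.var 11 (by decide), e11, H₁.n]
    refine card_eq_count _ _ fun a => ?_
    simp only [Finset.mem_compl, mem_dummyAgents, not_forall, not_not]
    exact ⟨fun ⟨h, hh⟩ => ⟨h, h.2, edge_iff.2 hh⟩, fun ⟨h, h1, h2⟩ => ⟨⟨h, h1⟩, edge_iff.1 h2⟩⟩
  have hH : I.dummyHousesᶜ.card = s₃.var 12 := by
    rw [e12, H₂.m]
    refine card_eq_count _ _ fun a => ?_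
    simp only [Finset.mem_compl, mem_dummyHouses, not_forall, not_not]
    exact ⟨fun ⟨h, hh⟩ => ⟨h, edge_iff.2 hh⟩, fun ⟨a, h1⟩ => ⟨⟨a, h1.1⟩, edge_iff.1 h1⟩⟩
  have a31 : s₃.arr 1 = s.arr 1 := by
    rw [f₃.arr 1 (by decide), f₂.arr 1 (by decide), f₁.arr 1 (by decide), a1]
  have a33 : s₃.arr 3 = s₁.arr 3 := by
    rw [f₃.arr 3 (by decide), f₂.arr 3 (by decide)]
  refine .seq ((runs_image H₃ hn ?_ (fun a => s₁.arr 3 a ≠ 0) (s.arr 1) (fun s' hf => ?_)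
    (fun s' hf => ?_)).mono fun s₄ f₄ hI => ?_)
  · rw [f₃.arr 5 (by decide), f₂.arr 5 (by decide), f₁.arr 5 (by decide)]
    exact h5
  · simp only [Exp.eval, hf.arr 3 (by decide), a33]
  · simp only [Exp.eval, hf.arr 1 (by decide), a31]
  have hI' : ∀ l, s₄.arr 5 l ≠ 0 ↔ ∃ a < I.n, (∃ h < I.m, I.Edge a h) ∧ s.arr 1 a = l := by
    intro l
    rw [hI]
    refine exists_congr fun a => and_congr_right fun ha => ?_
    rw [hr' a ha]
  have v11 : s₄.var 11 = I.dummyAgentsᶜ.card := by rw [hA, f₄.var 11 (by decide)]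
  have v12 : s₄.var 12 = I.dummyHousesᶜ.card := by rw [hH, f₄.var 12 (by decide)]
  refine .ite (fun h => .seq (.assign ?_)) fun h => .skip ?_
  · simp only [Exp.eval, v11, v12] at h
    -- Pigeonhole bounds both the number of rounds of the search and the threshold found.
    have le : ∀ i, (∀ l < i, s₄.arr 5 l ≠ 0) → i ≤ I.n := fun i hi =>
      Labelling.label_le (d := s.arr 1) (P := fun a => ∃ h < I.m, I.Edge a h)
        fun l hl => (hI' l).1 (hi l hl)
    refine .loop (fun s' => ∀ l < s'.var 13, s₄.arr 5 l ≠ 0) (fun s' => I.n - s'.var 13)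
      (by simp [Exp.eval]) (le_trans (Nat.sub_le _ _) hn) ?_ ?_
    · intro s' hf hlow hne
      simp only [Exp.eval, hf.arr 5 (by decide), State.setVar_arr] at hne
      have hlow' : ∀ l < s'.var 13 + 1, s₄.arr 5 l ≠ 0 := by
        intro l hl
        rcases Nat.lt_succ_iff_lt_or_eq.1 hl with hl | rfl
        · exact hlow l hl
        · exact hne
      have := le _ hlow'
      refine .assign ⟨by simpa [Exp.eval] using hlow', ?_⟩
      simp [Exp.eval]; omega
    · intro s' hf hlow hz
      simp only [Exp.eval, hf.arr 5 (by decide), State.setVar_arr] at hz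
      exact .inr ⟨by omega, le _ hlow, fun l hl => (hI' l).1 (hlow l hl),
        fun h' => (hI' _).2 h' hz⟩
  · simp only [Exp.eval, v11, v12] at h
    refine .inl ⟨by omega, ?_⟩
    rw [f₄.var 13 (by decide), f₃.var 13 (by decide), f₂.var 13 (by decide),
      f₁.var 13 (by decide), v13]

/-! ### The output -/

namespace Prog

/-- Mark the eliminated houses (shifted by one) in the array `6` and the houses that remain
non-dummy in the array `8`, and count the remaining agents, houses and dummy houses in the
variables `14`, `15` and `16`. -/
def survivors : Prog :=
  .seq (.image 6 (.sub (.get 1 (.var 3)) (.var 13)) (.get 2 (.var 3))) <|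
  .seq (.marks 7 8) <|
  .seq (.count 14 0 (.sub (.const 1) (.sub (.get 1 (.var 3)) (.var 13)))) <|
  .seq (.count 15 1 (.sub (.const 1) (.get 6 (.add (.var 3) (.const 1))))) <|
  .count 16 1 (.sub (.const 1)
    (.add (.get 6 (.add (.var 3) (.const 1))) (.get 8 (.var 3))))

/-- Overwrite the matrix with its restriction to the remaining agents and houses. -/
def compress : Prog :=
  .seq (.assign 17 (.const 0)) <|
  .seq (.matrix <| .ite (.sub (.const 1)
      (.add (.sub (.get 1 (.var 3)) (.var 13)) (.get 6 (.add (.var 4) (.const 1)))))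
    (.seq (.put 0 (.var 17) (.get 0 (.var 5))) (.assign 17 (.add (.var 17) (.const 1)))) .skip) <|
  .seq (.assign 0 (.var 14)) (.assign 1 (.var 15))

/-- Write the trivial yes-instance. -/
def writeTrivial : Prog :=
  .seq (.assign 0 (.const 2)) <| .seq (.assign 1 (.const 2)) <|
  .seq (.put 0 (.const 0) (.const 1)) <| .seq (.put 0 (.const 1) (.const 0)) <|
  .seq (.put 0 (.const 2) (.const 0)) (.put 0 (.const 3) (.const 1))

/-- Apply the two rules exhaustively. -/
def kernelize : Prog :=
  .seq .auction <| .seq .threshold <| .seq .survivors <|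
  .ite (.sub (.add (.var 16) (.const 1)) (.var 14)) .writeTrivial .compress

end Prog

theorem runs_survivors {I : Instance} {N : ℕ} {s : State} (hs : Holds I s) (hn : I.n ≤ N)
    (hm : I.m ≤ N) (h6 : s.arr 6 = fun _ => 0) (h7 : s.arr 7 = fun _ => 0)
    (h8 : s.arr 8 = fun _ => 0) (p q P : ℕ → Prop) [DecidablePred p] [DecidablePred q]
    [DecidablePred P] (hp : ∀ a, p a ↔ s.arr 1 a ≤ s.var 13)
    (hq : ∀ h, q h ↔ ¬ ∃ a < I.n, s.var 13 < s.arr 1 a ∧ s.arr 2 a = h + 1)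
    (hP : ∀ h, P h ↔ q h ∧ ¬ ∃ a, p a ∧ I.Edge a h) :
    Runs N .survivors s fun s' => (∀ h, s'.arr 6 (h + 1) = 0 ↔ q h) ∧
      s'.var 14 = Nat.count p I.n ∧ s'.var 15 = Nat.count q I.m ∧ s'.var 16 = Nat.count P I.m := by
  refine .seq ((runs_image hs hn h6 (fun a => s.var 13 < s.arr 1 a) (s.arr 2) (fun s' hf => ?_)
    (fun s' hf => ?_)).mono fun s₁ f₁ hI => ?_)
  · simp only [Exp.eval, hf.arr 1 (by decide), hf.var 13 (by decide)]
    omega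
  · simp only [Exp.eval, hf.arr 2 (by decide)]
  have H₁ := hs.of_frame f₁ (by decide)
  have hI' : ∀ h, s₁.arr 6 (h + 1) = 0 ↔ q h := by
    intro h
    rw [hq, ← hI, not_not]
  refine .seq ((runs_marks H₁ hn hm (by decide) (by decide) (by decide)
    ((f₁.arr 7 (by decide)).trans h7) ((f₁.arr 8 (by decide)).trans h8)).mono
    fun s₂ f₂ ⟨_, hc⟩ => ?_)
  have H₂ := H₁.of_frame f₂ (by decide)
  have hc' : ∀ h, s₂.arr 8 h = 0 ↔ ¬ ∃ a, p a ∧ I.Edge a h := by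
    intro h
    have := hc h
    rw [f₁.arr 1 (by decide), f₁.var 13 (by decide)] at this
    simp only [hp, ← this, not_not]
  have a26 : s₂.arr 6 = s₁.arr 6 := f₂.arr 6 (by decide)
  refine .seq (.count p (by rwa [H₂.n]) (by decide) (by decide)
    (by decide) (fun i hi s' hf h3 => ?_) fun s₃ f₃ e14 => ?_)
  · simp only [Exp.eval, h3, hf.arr 1 (by decide), f₂.arr 1 (by decide), f₁.arr 1 (by decide),
      hf.var 13 (by decide), f₂.var 13 (by decide), f₁.var 13 (by decide), hp]
    omega
  have H₃ := H₂.of_frame f₃ (by decide)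
  refine .seq (.count q (by rwa [H₃.m]) (by decide) (by decide)
    (by decide) (fun i hi s' hf h3 => ?_) fun s₄ f₄ e15 => ?_)
  · simp only [Exp.eval, h3, hf.arr 6 (by decide), f₃.arr 6 (by decide), a26, ← hI']
    omega
  have H₄ := H₃.of_frame f₄ (by decide)
  refine .count P (by rwa [H₄.m]) (by decide) (by decide)
    (by decide) (fun i hi s' hf h3 => ?_) fun s₅ f₅ e16 => ?_
  · simp only [Exp.eval, h3, hf.arr 6 (by decide), f₄.arr 6 (by decide), f₃.arr 6 (by decide), a26,
      hf.arr 8 (by decide), f₄.arr 8 (by decide), f₃.arr 8 (by decide), hP, ← hI', ← hc']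
    omega
  refine ⟨fun h => ?_, ?_, ?_, ?_⟩
  · rw [f₅.arr 6 (by decide), f₄.arr 6 (by decide), f₃.arr 6 (by decide), a26, hI']
  · rw [f₅.var 14 (by decide), f₄.var 14 (by decide), e14, H₂.n]
  · rw [f₅.var 15 (by decide), e15, H₃.m]
  · rw [e16, H₄.m]

theorem runs_writeTrivial {N : ℕ} {s : State} :
    Runs N .writeTrivial s fun s' => s'.Outputs (trivialYes (s.var 2)) := by
  refine .seq (.assign (.seq (.assign (.seq (.put (.seq (.put (.seq (.put (.put ?_))))))))))
  refine ⟨by simp [Exp.eval, trivialYes], by simp [Exp.eval, trivialYes],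
    by simp [Exp.eval, trivialYes], fun (a : Fin 2) (h : Fin 2) => ?_⟩
  fin_cases a <;> fin_cases h <;> simp [Exp.eval, trivialYes]

theorem runs_compress {I : Instance} {N : ℕ} {s : State} (hs : Holds I s) (hn : I.n ≤ N)
    (hm : I.m ≤ N) (p q : ℕ → Prop) [DecidablePred p] [DecidablePred q]
    (hp : ∀ a, p a ↔ s.arr 1 a ≤ s.var 13) (hq : ∀ h, s.arr 6 (h + 1) = 0 ↔ q h)
    (h14 : s.var 14 = Nat.count p I.n) (h15 : s.var 15 = Nat.count q I.m) :
    Runs N .compress s fun s' => s'.Outputs (I.restrict p q) := by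
  have H₀ : Holds I (s.setVar 17 0) := hs.setVar (by decide)
  refine .seq (.assign (.seq ?_))
  refine .matrix (fun i j s' =>
    s'.var 17 = Nat.count p i * Nat.count q I.m + (if p i then Nat.count q j else 0) ∧
    (∀ l, i * I.m + j ≤ l → s'.arr 0 l = I.input.arr 0 l) ∧
    ∀ a h, p a → q h → (a < i ∧ h < I.m ∨ a = i ∧ h < j) →
      s'.arr 0 (Nat.count p a * Nat.count q I.m + Nat.count q h) = I.input.arr 0 (a * I.m + h))
    H₀.n H₀.m hn hm (by decide) ?_ ?_ ?_ ?_ ?_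
  · rintro i j s x v hx ⟨h1, h2⟩
    refine ⟨?_, h2⟩
    rw [State.setVar_var, if_neg, h1]
    rintro rfl
    simp at hx
  · refine ⟨by simp [Exp.eval], by simp [hs.u], ?_⟩
    intro a h _ _ h'
    omega
  · intro i hi j hj s' hf h3 h4 h5 ⟨h17, hrest, hdone⟩
    have a1 : s'.arr 1 = s.arr 1 := hf.arr 1 (by decide)
    have a6 : s'.arr 6 = s.arr 6 := hf.arr 6 (by decide)
    have v13 : s'.var 13 = s.var 13 := hf.var 13 (by decide)
    have key : (Exp.sub (.const 1) (.add (.sub (.get 1 (.var 3)) (.var 13))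
        (.get 6 (.add (.var 4) (.const 1))))).eval s' ≠ 0 ↔ p i ∧ q j := by
      simp only [Exp.eval, a1, a6, v13, h3, h4, hp, ← hq]
      omega
    refine .ite (fun h => .seq (.put (.assign ?_))) fun h => .skip ?_
    · obtain ⟨hpi, hqj⟩ := key.1 h
      rw [if_pos hpi] at h17
      -- The matrix is compressed in place: the write position never passes the read position, so
      -- unread entries are intact.
      have hle : s'.var 17 ≤ i * I.m + j := by
        rw [h17]
        exact add_le_add (Nat.mul_le_mul (Nat.count_le _) (Nat.count_le _)) (Nat.count_le _)
      simp only [Exp.eval, State.setVar_var, State.setVar_arr, State.setArr_arr, State.setArr_var,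
        if_true, hpi, h5]
      refine ⟨?_, ?_, ?_⟩
      · rw [h17, Nat.count_succ, if_pos hqj]
        ring
      · intro l hl
        rw [Function.update_of_ne (by omega)]
        exact hrest l (by omega)
      · intro a h' hpa hqh hlt
        by_cases heq : a = i ∧ h' = j
        · obtain ⟨rfl, rfl⟩ := heq
          rw [← h17, Function.update_self]
          exact hrest _ le_rfl
        · have hlt' : a < i ∧ h' < I.m ∨ a = i ∧ h' < j := by omega
          rw [Function.update_of_ne]
          · exact hdone a h' hpa hqh hlt'
          -- Entries written earlier have strictly smaller target positions, since counting
          -- surviving rows and columns preserves the lexicographic order.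
          · rw [h17]
            rcases hlt' with ⟨h1, h2⟩ | ⟨rfl, h2⟩
            · have e1 := count_lt_count_of_lt h1 hpa
              have e2 := count_lt_count_of_lt h2 hqh
              have e3 := Nat.mul_le_mul_right (Nat.count q I.m) (Nat.succ_le_of_lt e1)
              rw [Nat.succ_mul] at e3
              omega
            · have e2 := count_lt_count_of_lt h2 hqh
              omega
    · have hno := (not_congr key).1 (not_not.2 h)
      refine ⟨?_, fun l hl => hrest l (by omega), fun a h' hpa hqh hlt => ?_⟩
      · rw [h17]
        by_cases hpi : p i
        · have hqj : ¬ q j := fun hqj => hno ⟨hpi, hqj⟩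
          simp [hpi, Nat.count_succ, hqj]
        · simp [hpi]
      · refine hdone a h' hpa hqh ?_
        by_cases heq : a = i ∧ h' = j
        · obtain ⟨rfl, rfl⟩ := heq
          exact absurd ⟨hpa, hqh⟩ hno
        · omega
  · rintro i s' ⟨h17, hrest, hdone⟩
    refine ⟨?_, fun l hl => hrest l ?_, fun a h hpa hqh hlt => hdone a h hpa hqh (by omega)⟩
    · rw [h17, Nat.count_succ]
      by_cases hpi : p i
      · simp [hpi, Nat.succ_mul]
      · simp [hpi]
    · rw [Nat.succ_mul] at hl; omega
  · rintro s' hf ⟨-, -, hdone⟩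
    refine .seq (.assign (.assign ⟨?_, ?_, ?_, fun a h => ?_⟩))
    · simp [Exp.eval, hf.var 14 (by decide), h14, restrict]
    · simp [Exp.eval, hf.var 15 (by decide), h15, restrict]
    · simp [hf.var 2 (by decide), hs.k, restrict]
    · have ha := (I.restrictAgent p q a).2
      have hh := (I.restrictHouse p q h).2
      have hpa := (I.mem_range_restrictAgent p q _).1 ⟨a, rfl⟩
      have hqh := (I.mem_range_restrictHouse p q _).1 ⟨h, rfl⟩
      have h1 : Nat.count p (I.restrictAgent p q a) = a :=
        Nat.count_nth fun hfin => a.2.trans_le (Nat.count_le_card hfin I.n)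
      have h2 : Nat.count q (I.restrictHouse p q h) = h :=
        Nat.count_nth fun hfin => h.2.trans_le (Nat.count_le_card hfin I.m)
      have := hdone _ _ hpa hqh (.inl ⟨ha, hh⟩)
      rw [h1, h2, input_apply] at this
      exact this

/-- The program `kernelize` applies the rules exhaustively. -/
theorem runs_kernelize {I : Instance} {N : ℕ} (hn : I.n ≤ N) (hm : I.m ≤ N)
    (hN : I.n * (I.n + 1) + 1 ≤ N) :
    Runs N .kernelize I.input fun s => ∃ J, ReducesTo I J ∧ s.Outputs J := by
  classical
  have H₀ := holds_input I
  have zero : ∀ x ≠ 0, I.input.arr x = fun _ => 0 := by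
    intro x hx; simp [Instance.input, hx]
  refine .seq ((runs_auction H₀ hn hm hN (zero 1 (by decide)) (zero 2 (by decide))).mono
    fun s₁ f₁ L => ?_)
  have H₁ := H₀.of_frame f₁ (by decide)
  have zero₁ : ∀ x ∈ [3, 4, 5, 6, 7, 8], s₁.arr x = fun _ => 0 := by
    intro x hx
    rw [f₁.arr x, zero x]
    · rintro rfl; simp at hx
    · revert x; decide
  refine .seq ((runs_threshold H₁ hn hm L.le (zero₁ 3 (by decide)) (zero₁ 4 (by decide))
    (zero₁ 5 (by decide))).mono fun s₂ f₂ hT => ?_)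
  have H₂ := H₁.of_frame f₂ (by decide)
  rw [← f₂.arr 1 (by decide)] at hT L
  rw [← f₂.arr 2 (by decide)] at L
  let q : ℕ → Prop := fun h => ¬ ∃ a < I.n, s₂.var 13 < s₂.arr 1 a ∧ s₂.arr 2 a = h + 1
  let p : ℕ → Prop := fun a => s₂.arr 1 a ≤ s₂.var 13
  let P : ℕ → Prop := fun h => q h ∧ ¬ ∃ a, p a ∧ I.Edge a h
  obtain ⟨hR, hJ⟩ := L.restrict_spec hT q fun _ => Iff.rfl
  refine .seq ((runs_survivors H₂ hn hm ((f₂.arr 6 (by decide)).trans (zero₁ 6 (by decide)))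
    ((f₂.arr 7 (by decide)).trans (zero₁ 7 (by decide)))
    ((f₂.arr 8 (by decide)).trans (zero₁ 8 (by decide))) p q P (fun _ => Iff.rfl)
    (fun _ => Iff.rfl) fun _ => Iff.rfl).mono fun s₃ f₃ ⟨h6, h14, h15, h16⟩ => ?_)
  have H₃ := H₂.of_frame f₃ (by decide)
  have hdummy := card_dummyHouses_restrict I p q P fun _ => Iff.rfl
  -- At most one application of `Rule2` precedes the final test of `Rule1`.
  have lift : ∀ K, ReducesTo (I.restrict p q) K → ReducesTo I K := by
    intro K hK
    rcases hR with hR | hR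
    · rwa [show I.restrict p q = I from hR] at hK
    · exact .rule2 I _ K hR hK
  have hrule : (I.restrict p q).Rule1 ↔ Nat.count p I.n ≤ Nat.count P I.m := by
    rw [← hdummy]; rfl
  refine .ite (fun h => ?_) fun h => ?_
  · simp only [Exp.eval, h14, h16] at h
    refine runs_writeTrivial.mono fun s₄ _ hO => ⟨_, lift _ (.rule1 _ (hrule.2 (by omega))), ?_⟩
    rwa [H₃.k] at hO
  · simp only [Exp.eval, h14, h16] at h
    refine (runs_compress H₃ hn hm p q (fun a => ?_) h6 h14 h15).mono
      fun s₄ _ hO => ⟨_, lift _ (.reduced _ (fun h' => ?_) (not_rule2 hJ)), hO⟩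
    · rw [f₃.arr 1 (by decide), f₃.var 13 (by decide)]
    · have := hrule.1 h'
      omega

/-! ### The size of reduced instances -/

/-- Existence is read off from the verified run of the auction. -/
theorem exists_labelling (I : Instance) :
    ∃ d o, Labelling I.n I.m I.Edge d o I.m 0 := by
  obtain ⟨-, s, -, -, h⟩ := runs_auction (N := I.n + I.m + (I.n * (I.n + 1) + 1)) (holds_input I)
    (by omega) (by omega) (by omega) (by simp [Instance.input]) (by simp [Instance.input])
  exact ⟨_, _, h⟩

/-- The auction either yields an application of `Rule2`, which is excluded, or eliminates nothing;
then the conclusion about the restriction is one about `I` itself. -/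
theorem card_of_not_rule2 {I : Instance} (h : ∀ J, ¬ I.Rule2 J) :
    I.dummyHousesᶜ.card < I.dummyAgentsᶜ.card ∨ I.dummyHousesᶜ = ∅ := by
  classical
  obtain ⟨d, o, L⟩ := exists_labelling I
  obtain ⟨t, ht⟩ := Labelling.exists_isThreshold I d
  obtain ⟨h1, h2⟩ := L.restrict_spec ht (fun h => ¬ ∃ a < I.n, t < d a ∧ o a = h + 1)
    fun _ => Iff.rfl
  rwa [h1.resolve_right (h _)] at h2

/-- There are at most `n - 1` dummy houses, and either at most `n - 1` others or none. Failure of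
`Rule1` also forces `n ≥ 1`, so the bound is meaningful in the integers. -/
theorem card_of_reduced {I : Instance} (h1 : ¬ I.Rule1) (h2 : ∀ J, ¬ I.Rule2 J) :
    (I.m : ℤ) ≤ 2 * ((I.n : ℤ) - 1) := by
  have h3 := card_of_not_rule2 h2
  have h4 := Finset.card_add_card_compl I.dummyHouses
  have h5 := Finset.card_le_univ I.dummyAgentsᶜ
  rw [Fintype.card_fin] at h4 h5
  unfold Rule1 at h1
  rcases h3 with h3 | h3
  · omega
  · rw [h3, Finset.card_empty] at h4
    omega

theorem ReducesTo.spec {I J : Instance} (h : ReducesTo I J) :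
    J.k = I.k ∧ J.n ≤ max I.n 2 ∧ (I.n ≤ I.m → J.n ≤ J.m) ∧
      (J.m : ℤ) ≤ 2 * ((J.n : ℤ) - 1) ∧
      (I.OHA ↔ J.OHA) ∧ (I.EHA ↔ J.EHA) ∧ (I.UHA ↔ J.UHA) := by
  induction h with
  | rule1 I h =>
    obtain ⟨h1, h2, h3⟩ := yes_of_rule1 h
    obtain ⟨h4, h5, h6⟩ := yes_trivialYes I.k
    exact ⟨rfl, le_max_right _ _, fun _ => le_rfl, by simp [trivialYes],
      iff_of_true h1 h4, iff_of_true h2 h5, iff_of_true h3 h6⟩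
  | rule2 I J K h _ ih =>
    obtain ⟨k1, k2, k3, k4, k5, k6, k7⟩ := ih
    obtain ⟨c, hc⟩ := h.card
    obtain ⟨h1, h2, h3⟩ := h.problems_iff
    obtain ⟨-, -, -, -, -, -, -, -, -, -, hk, -⟩ := h
    exact ⟨k1.trans hk, by omega, fun _ => k3 (by omega), k4, h1.trans k5, h2.trans k6,
      h3.trans k7⟩
  | reduced I h1 h2 =>
    exact ⟨rfl, le_max_left _ _, id, card_of_reduced h1 h2, .rfl, .rfl, .rfl⟩

/-! ### Lowering the budget -/

theorem Instance.envy_le (I : Instance) (Φ : I.Allocation) (a : Fin I.n) : I.envy Φ a ≤ I.n := by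
  unfold envy
  exact (Finset.card_le_univ _).trans (by simp)

/-- None of the three objectives ever exceeds `n ^ 2`, so a larger budget has no effect. -/
theorem Instance.truncate_iff (I : Instance) :
    (I.OHA ↔ I.truncate.OHA) ∧ (I.EHA ↔ I.truncate.EHA) ∧ (I.UHA ↔ I.truncate.UHA) := by
  have hsq : I.n ≤ I.n ^ 2 := Nat.le_self_pow (by decide) _
  refine ⟨exists_congr fun Φ => ?_, exists_congr fun Φ => ?_, exists_congr fun Φ => ?_⟩
  · have : I.numEnvious Φ ≤ I.n ^ 2 :=
      ((Finset.card_le_univ _).trans (by simp)).trans hsq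
    exact ⟨fun h => le_min h this, fun h => h.trans (min_le_left _ _)⟩
  · have : I.maxEnvy Φ ≤ I.n ^ 2 := Finset.sup_le fun a _ => (I.envy_le Φ a).trans hsq
    exact ⟨fun h => le_min h this, fun h => h.trans (min_le_left _ _)⟩
  · have : I.totalEnvy Φ ≤ I.n ^ 2 := by
      have := Finset.sum_le_card_nsmul Finset.univ (fun a => I.envy Φ a) I.n
        fun a _ => I.envy_le Φ a
      simpa [sq, totalEnvy] using this
    exact ⟨fun h => le_min h this, fun h => h.trans (min_le_left _ _)⟩

theorem Instance.size_truncate_le {I : Instance} {x : ℕ} (hn : I.n ≤ x) (hm : I.m ≤ 2 * x) :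
    I.truncate.size + I.truncate.n ≤ 3 * x ^ 2 + 4 * x := by
  have h1 : Nat.size (min I.k (I.n ^ 2)) ≤ x ^ 2 :=
    (Nat.size_le.2 Nat.lt_two_pow_self).trans
      ((min_le_right _ _).trans (Nat.pow_le_pow_left hn 2))
  have h2 : I.n * I.m ≤ 2 * x ^ 2 := (Nat.mul_le_mul hn hm).trans_eq (by ring)
  change I.n + I.m + I.n * I.m + Nat.size (min I.k (I.n ^ 2)) + I.n ≤ _
  omega

/-- Lower the budget of the instance in the memory. -/
def Prog.lower : Prog :=
  .seq (.assign 18 (.const 0)) <|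
  .seq (.upTo 3 0 (.assign 18 (.add (.var 18) (.var 0)))) <|
  .ite (.sub (.var 2) (.var 18)) (.assign 2 (.var 18)) .skip

theorem runs_lower {J : Instance} {N : ℕ} {s : State} (hs : s.Outputs J) (hN : J.n ≤ N) :
    Runs N .lower s fun s' => s'.Outputs J.truncate := by
  obtain ⟨h0, h1, h2, hu⟩ := hs
  refine .seq (.assign (.seq (.upTo (fun i s' => s'.var 18 = i * J.n) ?_ (by decide) (by decide)
    (by decide) ?_ ?_ ?_)))
  · simpa [h0] using hN
  · simp [Exp.eval]
  · intro i _ s' hf _ h18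
    refine .assign ?_
    have e0 : s'.var 0 = J.n := by rw [hf.var 0 (by decide)]; simp [h0]
    simp [Exp.eval, h18, e0]
    ring
  · intro s' hf h18
    have e0 : s'.var 0 = J.n := by rw [hf.var 0 (by decide)]; simp [h0]
    have e1 : s'.var 1 = J.m := by rw [hf.var 1 (by decide)]; simp [h1]
    have e2 : s'.var 2 = J.k := by rw [hf.var 2 (by decide)]; simp [h2]
    have ea : s'.arr 0 = s.arr 0 := by rw [hf.arr 0 (by decide)]; simp
    have h18 : s'.var 18 = J.n ^ 2 := by rw [h18, sq]; simp [h0]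
    refine .ite (fun h => .assign ?_) fun h => .skip ?_
    · simp only [Exp.eval, e2, h18] at h
      refine ⟨by simpa [truncate] using e0, by simpa [truncate] using e1, ?_, fun a b => ?_⟩
      · simp only [Exp.eval, State.setVar_var, if_true, h18, truncate]
        omega
      · rw [State.setVar_arr, ea]
        exact hu a b
    · simp only [Exp.eval, e2, h18] at h
      refine ⟨e0, e1, ?_, fun a b => ?_⟩
      · rw [e2]
        simp only [truncate]
        omega
      · rw [ea]
        exact hu a b

/-! ### Assembling the kernelization -/

/-- A bound on the number of rounds of every loop. -/
theorem rounds_le (I : Instance) : I.n + I.m + 2 ≤ (I.size + 2) ^ 2 ∧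
    I.n * (I.n + 1) + 1 ≤ (I.size + 2) ^ 2 := by
  have h : I.n + I.m ≤ I.size := by unfold Instance.size; omega
  constructor <;> nlinarith

theorem exists_kernel (I : Instance) : ∃ J, ReducesTo I J ∧
    Runs ((I.size + 2) ^ 2) .kernelize I.input fun s => s.Outputs J := by
  have h := rounds_le I
  obtain ⟨t, s, h1, h2, J, h3, h4⟩ := runs_kernelize (I := I) (N := (I.size + 2) ^ 2) (by omega)
    (by omega) h.2
  exact ⟨J, h3, t, s, h1, h2, h4⟩

theorem polyTime_of_runs {f : Instance → Instance} (p : Prog)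
    (h : ∀ I, Runs ((I.size + 2) ^ 2) p I.input fun s => s.Outputs (f I)) : PolyTime f := by
  refine ⟨p, p.timePoly.comp ((Polynomial.X + 2) ^ 2), fun I => ?_⟩
  obtain ⟨t, s, h1, h2, h3⟩ := h I
  exact ⟨t, s, h1, by simpa using h2, h3⟩

theorem isPolyKernelization_truncate {f : Instance → Instance} {Q : Instance → Prop}
    (hf : ∀ I, ReducesTo I (f I)) (ht : PolyTime fun I => (f I).truncate)
    (hQ : ∀ I, Q I ↔ Q (f I)) (hQ' : ∀ I, Q I ↔ Q I.truncate) :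
    IsPolyKernelization Q fun I => (f I).truncate := by
  refine ⟨ht, fun I => (hQ I).trans (hQ' _),
    3 * (Polynomial.X + 2) ^ 2 + 4 * (Polynomial.X + 2), fun I => ?_⟩
  obtain ⟨-, hn, -, hm, -⟩ := (hf I).spec
  -- The value `n + 2` covers `max n 2`, as the trivial yes-instance may have more agents than the
  -- input.
  have := size_truncate_le (I := f I) (x := I.n + 2) (by omega) (by omega)
  simpa using this

end HouseAllocation

open HouseAllocation in
theorem mainTheorem5 :
    (∀ I J : Instance, ReducesTo I J →
      J.k = I.k ∧ J.n ≤ max I.n 2 ∧ (I.n ≤ I.m → J.n ≤ J.m) ∧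
      (J.m : ℤ) ≤ 2 * ((J.n : ℤ) - 1) ∧
      (I.OHA ↔ J.OHA) ∧ (I.EHA ↔ J.EHA) ∧ (I.UHA ↔ J.UHA)) ∧
    ∃ f : Instance → Instance,
      PolyTime f ∧
      (∀ I, ReducesTo I (f I)) ∧
      IsPolyKernelization Instance.OHA (fun I => (f I).truncate) ∧
      IsPolyKernelization Instance.EHA (fun I => (f I).truncate) ∧
      IsPolyKernelization Instance.UHA (fun I => (f I).truncate) := by
  refine ⟨fun I J h => h.spec, ?_⟩
  -- The output is chosen separately for each instance, but always computed by the same program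
  -- `kernelize`.
  choose f hf hrun using exists_kernel
  have ht : PolyTime fun I => (f I).truncate := by
    refine polyTime_of_runs (.seq .kernelize .lower) fun I => .seq ((hrun I).mono fun s _ hs => ?_)
    have h1 := (hf I).spec.2.1
    have h2 := (rounds_le I).1
    exact runs_lower hs (by omega)
  exact ⟨f, polyTime_of_runs _ hrun, hf,
    isPolyKernelization_truncate hf ht (fun I => (hf I).spec.2.2.2.2.1) fun I => I.truncate_iff.1,
    isPolyKernelization_truncate hf ht (fun I => (hf I).spec.2.2.2.2.2.1)
      fun I => I.truncate_iff.2.1,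
    isPolyKernelization_truncate hf ht (fun I => (hf I).spec.2.2.2.2.2.2)
      fun I => I.truncate_iff.2.2⟩
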